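/- Let $\langle f,h\rangle=\int_{\mathbb R} f\overline h\,dx$ be the inner product of $L^2(\mathbb R)$, and let $H_2^+$ be the space of boundary values $f\in L^2(\mathbb R)$ of functions $F$ holomorphic in the upper half-plane with $\sup_{y>0}\int_{\mathbb R}|F(x+iy)|^2dx<\infty$. For $\phi,\psi\in L^2(\mathbb R)$ let $\widetilde A^*$ be the operator in $L^2(\mathbb R)$ with domain $\{u\in L^2(\mathbb R):\exists c_u\in\mathbb C,\ xu(x)-c_u\in L^2(\mathbb R)\}$ given by $(\widetilde A^*u)(x)=xu(x)-c_u+\langle u,\phi\rangle\psi(x)$. On this domain put $\Gamma_1u=\lim_{R\to\infty}\int_{-R}^Ru(x)\,dx$ and $\Gamma_2u=c_u$. For $B\in\mathbb C$ let $A_B$ be the restriction of $\widetilde A^*$ to $\ker(\Gamma_1-B\Gamma_2)$, with resolvent set $\rho(A_B)$. For $\mu\in\rho(A_B)$ let $S_{\mu,B}$ be the operator sending $f\in\mathbb C$ to the $u$ with $(\widetilde A^*-\mu)u=0$ and $(\Gamma_1-B\Gamma_2)u=f$. Fix $\mu_0\in\rho(A_B)$ and put $$\mathcal S_B=\operatorname{Span}_{\delta\in\rho(A_B)}(A_B-\delta)^{-1}\operatorname{Ran}S_{\mu_0,B},\qquad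 \mathcal T_B=\operatorname{Span}_{\mu\in\rho(A_B)}\operatorname{Ran}S_{\mu,B}.$$ Let $D(\lambda)=1+\int_{\mathbb R}\frac{\psi(x)\overline{\phi(x)}}{x-\lambda}dx$ for $\lambda\notin\mathbb R$, $D_-(k)=\lim_{\varepsilon\downarrow0}D(k-i\varepsilon)$, and $P_-f(k)=-\frac1{2\pi i}\lim_{\varepsilon\downarrow0}\int_{\mathbb R}\frac{f(x)}{x-(k-i\varepsilon)}dx$. **Proposition.** Let $\phi,\psi\in H_2^+$. Then the limit $D_-(k)$ exists and is nonzero for a.e. $k\in\mathbb R$, and for every $g\in L^2(\mathbb R)$ the limit $P_-(\psi\overline g)(k)$ exists for a.e. $k\in\mathbb R$. For $g\in L^2(\mathbb R)$ consider the two conditions (I) $g\in H_2^+$; (II) $\overline g=-\dfrac{2\pi i}{D_-}\,\overline\phi\,P_-(\psi\overline g)$ a.e. on $\mathbb R$. For every $B\in\mathbb C\setminus\{\pi i,-\pi i\}$ the set $\rho(A_B)$ is nonempty and, for every choice of $\mu_0\in\rho(A_B)$ and every $g\in L^2(\mathbb R)$, $$g\in\mathcal S_B^\perp\iff g\in\mathcal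 T_B^\perp\iff\text{(I) and (II) hold}.$$ Moreover, for every $g\in L^2(\mathbb R)$, $$g\in\bigcap_{B\in\mathbb C}\ \bigcap_{\mu\in\rho(A_B)}\ker S_{\mu,B}^*\iff\text{(I) and (II) hold}.$$ -/

import Mathlib

open Filter Topology MeasureTheory

noncomputable section

namespace Friedrichs

/-- The Hilbert space `L²(ℝ)` of complex valued functions. -/
abbrev L2 : Type := Lp ℂ 2 (volume : Measure ℝ)

/-- The Hardy space `H₂⁺(ℝ)`: boundary values (in `L²`) of the functions `F` holomorphic in the
upper half-plane with `sup_{y > 0} ∫ |F (x + i y)|² dx < ∞`. -/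
def hardyPlus : Set L2 :=
  {f | ∃ F : ℂ → ℂ, DifferentiableOn ℂ F {z : ℂ | 0 < z.im} ∧
    (∃ C : NNReal, ∀ y : ℝ, 0 < y →
      eLpNorm (fun x : ℝ => F (x + y * Complex.I)) 2 volume ≤ C) ∧
    Tendsto (fun y : ℝ => eLpNorm (fun x : ℝ => F (x + y * Complex.I) - f x) 2 volume)
      (𝓝[>] 0) (𝓝 0)}

/-- The Cauchy (Borel) transform `f̂(z) = ∫ f(x) / (x - z) dx`. -/
def cauchyTransform (f : ℝ → ℂ) (z : ℂ) : ℂ := ∫ x : ℝ, f x / (x - z)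

/-- The pointwise boundary value `lim_{ε ↓ 0} F(k - i ε)` from the lower half-plane. -/
def lowerBoundaryValue (F : ℂ → ℂ) (k : ℝ) : ℂ :=
  limUnder (𝓝[>] (0 : ℝ)) fun ε : ℝ => F (k - ε * Complex.I)

/-- `P₋ f (k) = - (2πi)⁻¹ lim_{ε ↓ 0} f̂(k - i ε)`, with the limit taken pointwise, so that it
makes sense almost everywhere also for integrable `f`. -/
def rieszMinus (f : ℝ → ℂ) (k : ℝ) : ℂ :=
  -(1 / (2 * Real.pi * Complex.I)) * lowerBoundaryValue (cauchyTransform f) k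

/-- `D(z) = 1 + ∫ ψ(x) conj(φ(x)) / (x - z) dx`. -/
def D (φ ψ : L2) (z : ℂ) : ℂ :=
  1 + cauchyTransform (fun x => ψ x * starRingEnd ℂ (φ x)) z

/-- The boundary value `D₋(k) = D(k - i0)`. -/
def Dminus (φ ψ : L2) (k : ℝ) : ℂ := lowerBoundaryValue (D φ ψ) k

/-- `u ∈ Dom(Ã*)`, `c_u = c` and `Ã* u = w`, that is `w(x) = x u(x) - c + ⟨u, φ⟩ ψ(x)`.
As `ψ` and `w` are in `L²`, this contains the condition `x u - c 𝟏 ∈ L²`.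
Mathlib's inner product is linear in the second argument: `⟨u, φ⟩ = inner ℂ φ u`. -/
def AdjointRel (φ ψ u : L2) (c : ℂ) (w : L2) : Prop :=
  ∀ᵐ x : ℝ, w x = x * u x - c + inner ℂ φ u * ψ x

/-- `Γ₁ u = a`, where `Γ₁ u = lim_{R → ∞} ∫_{-R}^R u(x) dx`. The other trace is `Γ₂ u = c_u`. -/
def TraceOneRel (u : L2) (a : ℂ) : Prop :=
  Tendsto (fun R : ℝ => ∫ x in (-R)..R, u x) atTop (𝓝 a)

/-- The graph of `A_B`, the restriction of `Ã*` to `ker (Γ₁ - B Γ₂)`. -/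
def graphAB (φ ψ : L2) (B : ℂ) : Set (L2 × L2) :=
  {p | ∃ a c : ℂ, AdjointRel φ ψ p.1 c p.2 ∧ TraceOneRel p.1 a ∧ a - B * c = 0}

/-- The resolvent set `ρ(A_B)`: all `z` for which `A_B - z` maps its domain bijectively onto
`L²(ℝ)` with a bounded inverse `R`; here `(A_B - z) u = f` reads `(u, f + z u) ∈ graph A_B`. -/
def resolventSetAB (φ ψ : L2) (B : ℂ) : Set ℂ :=
  {z | ∃ R : L2 →L[ℂ] L2, ∀ u f : L2, (u, f + z • u) ∈ graphAB φ ψ B ↔ u = R f}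

/-- The range of the solution operator `S_{z,B}`, which sends `f` to the `u` with
`(Ã* - z) u = 0` and `(Γ₁ - B Γ₂) u = f`. -/
def solutionRange (φ ψ : L2) (B z : ℂ) : Set L2 :=
  {u | ∃ f a c : ℂ, AdjointRel φ ψ u c (z • u) ∧ TraceOneRel u a ∧ a - B * c = f}

/-- `𝒮_B = Span_{δ ∈ ρ(A_B)} (A_B - δ)⁻¹ Ran S_{μ₀,B}`. -/
def spaceS (φ ψ : L2) (B μ₀ : ℂ) : Submodule ℂ L2 :=
  Submodule.span ℂ {v | ∃ δ ∈ resolventSetAB φ ψ B, ∃ u ∈ solutionRange φ ψ B μ₀,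
    (v, u + δ • v) ∈ graphAB φ ψ B}

/-- `𝒯_B = Span_{μ ∈ ρ(A_B)} Ran S_{μ,B}`. -/
def spaceT (φ ψ : L2) (B : ℂ) : Submodule ℂ L2 :=
  Submodule.span ℂ (⋃ μ ∈ resolventSetAB φ ψ B, solutionRange φ ψ B μ)

/-- `⋂_B ⋂_{μ ∈ ρ(A_B)} ker S_{μ,B}^*`, where `ker S_{μ,B}^* = (Ran S_{μ,B})^⊥`. -/
def kernelIntersection (φ ψ : L2) : Set L2 :=
  {g | ∀ B : ℂ, ∀ μ ∈ resolventSetAB φ ψ B, ∀ u ∈ solutionRange φ ψ B μ, inner ℂ u g = 0}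

/-- (I) `g ∈ H₂⁺`, and (II) `conj g = - (2πi / D₋) conj φ P₋(ψ conj g)` almost everywhere. -/
def Criterion (φ ψ g : L2) : Prop :=
  g ∈ hardyPlus ∧
  ∀ᵐ k : ℝ, starRingEnd ℂ (g k) =
    -(2 * Real.pi * Complex.I / Dminus φ ψ k) * starRingEnd ℂ (φ k) *
      rieszMinus (fun x => ψ x * starRingEnd ℂ (g x)) k

end Friedrichs

end

/-! For nonreal z the equation (Ã* - z)u = f can be divided by x - z: then u = c/(x - z) + (f -
qψ)/(x - z) with only two unknown scalars, c = c_u and q = ⟨u, φ⟩. Pairing with φ and imposing the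
boundary condition give a 2×2 linear system for (c, q), and z lies in ρ(A_B) exactly when its
determinant `pertDet` is nonzero. For φ, ψ ∈ H₂⁺ the Cauchy transform of ψ vanishes below the real
line and that of conj φ above it, so the determinant is D(z)(±πi - B). Hence for B ≠ ±πi the nonreal
part of ρ(A_B) is the set where D ≠ 0.

Writing ^ for the Cauchy transform, orthogonality of g to the solutions of (Ã* - z)u = 0 reads
D(z)(conj g)^(z) = (conj φ)^(z)(ψ conj g)^(z). Above the real line the right side vanishes, hence so
does (conj g)^, and this is (I). Below it, passing to boundary values gives (II). The way back from
(II) is a uniqueness theorem: Cauchy transforms are quotients of bounded holomorphic functions, so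
they have vertical limits a.e. and vanish identically if these limits are a.e. zero
(`BddHol.exists_boundary`, `BddHol.ae_ne_zero`, `nev_cauchyTransform`, combined in `criterion_iff`).
Real points of ρ(A_B) are reached as limits of nonreal ones by a Neumann series.

The two spans are compared through S_{δ,B} f = S_{μ,B} f + (δ - μ)(A_B - δ)⁻¹ S_{μ,B} f
(`SolvesAt.shift`). If g ⊥ 𝒮_B, the pairing of S_{δ,B} f with g does not depend on δ; along δ = it,
S_{δ,B} f is a fixed multiple of 1/(x - it), which tends to 0 in norm, so the pairing is zero and g
⊥ 𝒯_B. -/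

noncomputable section

namespace Friedrichs

/-! ### Cauchy's theorem on a strip -/

open Complex in
/-- Contour shift: a holomorphic function that is integrable on a strip has the same integral over
both boundary lines. -/
theorem integral_line_eq_of_integrable_strip {F : ℂ → ℂ} {a b : ℝ} (hab : a ≤ b)
    (hF : DifferentiableOn ℂ F {z | a ≤ z.im ∧ z.im ≤ b})
    (ha : Integrable fun x : ℝ => F (x + a * I)) (hb : Integrable fun x : ℝ => F (x + b * I))
    (hs : Integrable (fun p : ℝ × ℝ => F (p.1 + p.2 * I))
      (volume.prod (volume.restrict (Set.Ioc a b)))) :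
    ∫ x : ℝ, F (x + a * I) = ∫ x : ℝ, F (x + b * I) := by
  set V : ℝ → ℂ := fun R => ∫ y in Set.Ioc a b, F (R + y * I) with hV
  have hVi : Integrable V := hs.integral_prod_left
  have hWi : Integrable fun R => V R - V (-R) := hVi.sub hVi.comp_neg
  have rect : ∀ R : ℝ, (∫ x : ℝ in (-R)..R, F (x + a * I)) - (∫ x : ℝ in (-R)..R, F (x + b * I))
      = -I * (V R - V (-R)) := by
    intro R
    have := integral_boundary_rect_eq_zero_of_differentiableOn F (-R + a * I) (R + b * I)
      (hF.mono (by
        intro z hz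
        simp only [mem_reProdIm, add_im, neg_im, ofReal_im, mul_im, ofReal_re, I_im, I_re, mul_one,
          mul_zero, neg_zero, zero_add, add_zero, Set.uIcc_of_le hab] at hz
        exact hz.2))
    simp only [add_im, neg_im, ofReal_im, mul_im, ofReal_re, I_im, I_re, mul_one, add_re, neg_re,
      mul_re, sub_zero,
      mul_zero, neg_zero, zero_add, add_zero, intervalIntegral.integral_of_le hab, smul_eq_mul]
      at this
    simp only [hV]
    linear_combination this
  have lim := ((intervalIntegral_tendsto_integral ha tendsto_neg_atTop_atBot tendsto_id).sub
    (intervalIntegral_tendsto_integral hb tendsto_neg_atTop_atBot tendsto_id)).const_mul I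
  have lim' : Tendsto (fun R => V R - V (-R)) atTop
      (𝓝 (I * ((∫ x : ℝ, F (x + a * I)) - ∫ x : ℝ, F (x + b * I)))) := by
    refine lim.congr fun R => ?_
    simp only [id]
    rw [rect R, ← mul_assoc, mul_neg, I_mul_I]; simp
  -- By Fubini the contribution of the vertical sides is integrable in R, and by the rectangle
  -- identity it converges. An integrable function can converge only to 0 at infinity, so no
  -- pointwise decay of `F` is needed.
  have hint : IntegrableAtFilter (fun R => V R - V (-R)) atTop := hWi.integrableAtFilter _
  have h0 := hint.eq_zero_of_tendsto (by
    intro s hs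
    obtain ⟨M, hM⟩ := mem_atTop_sets.1 hs
    refine top_le_iff.1 ?_
    rw [← Real.volume_Ici (a := M)]
    exact measure_mono fun x hx => hM x hx) lim'
  have := (mul_eq_zero.1 h0).resolve_left I_ne_zero
  exact sub_eq_zero.1 this

/-! ### Cauchy transforms of densities integrable against 1/(1 + |x|) -/

/-- The open upper half-plane. -/
def uhp : Set ℂ := {z | 0 < z.im}

theorem isOpen_uhp : IsOpen uhp := isOpen_lt continuous_const Complex.continuous_im

/-- Admissible densities for the Cauchy transform. -/
def Adm (f : ℝ → ℂ) : Prop := Integrable fun x : ℝ => f x * (((1 + |x|)⁻¹ : ℝ) : ℂ)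

theorem one_add_abs_pos (x : ℝ) : 0 < 1 + |x| := by positivity

theorem sub_ofReal_ne_zero {z : ℂ} (hz : z.im ≠ 0) (x : ℝ) : (x : ℂ) - z ≠ 0 := by
  intro h
  apply hz
  have := congrArg Complex.im h
  simpa using this

theorem exists_bound_inv_sub {z₀ : ℂ} (hz₀ : z₀.im ≠ 0) :
    ∃ C : ℝ, 0 < C ∧ ∀ z ∈ Metric.ball z₀ (|z₀.im| / 2), ∀ x : ℝ,
      z.im ≠ 0 ∧ ‖((x : ℂ) - z)⁻¹‖ ≤ C * (1 + |x|)⁻¹ := by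
  set δ := |z₀.im| / 2 with hδ
  have hδ0 : 0 < δ := by have := abs_pos.2 hz₀; positivity
  set M := ‖z₀‖ + δ
  -- Split 1 + |x| = (1 + M) + (|x| - M). The first part is controlled by |x - z| ≥ δ, the second by
  -- |x - z| ≥ |x| - M.
  refine ⟨(1 + M) / δ + 1, by positivity, fun z hz x => ?_⟩
  rw [Metric.mem_ball, dist_eq_norm] at hz
  have h1 : |z.im - z₀.im| < δ := lt_of_le_of_lt (by simpa using Complex.abs_im_le_norm (z - z₀)) hz
  have h2 : δ ≤ |z.im| := by
    have := abs_sub_abs_le_abs_sub z₀.im z.im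
    rw [abs_sub_comm] at this
    have : |z₀.im| = 2 * δ := by rw [hδ]; ring
    linarith
  have h3 : z.im ≠ 0 := abs_pos.1 (hδ0.trans_le h2)
  have h4 : |z.im| ≤ ‖(x : ℂ) - z‖ := by simpa using Complex.abs_im_le_norm ((x : ℂ) - z)
  have h5 : |x| - M ≤ ‖(x : ℂ) - z‖ := by
    have h6 : ‖z‖ ≤ M := by
      have := norm_sub_norm_le z z₀
      simp only [M]; linarith
    have := norm_sub_norm_le (x : ℂ) z
    rw [Complex.norm_real, Real.norm_eq_abs] at this
    linarith
  refine ⟨h3, ?_⟩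
  have hp : 0 < ‖(x : ℂ) - z‖ := by linarith
  rw [norm_inv, ← div_eq_mul_inv, le_div_iff₀ (one_add_abs_pos x), inv_mul_le_iff₀ hp]
  have : (1 + M) ≤ ‖(x : ℂ) - z‖ * ((1 + M) / δ) := by
    rw [mul_div_assoc', le_div_iff₀ hδ0, mul_comm]
    gcongr
    · linarith
  nlinarith

theorem aestronglyMeasurable_of_adm {f : ℝ → ℂ} (hf : Adm f) :
    AEStronglyMeasurable f := by
  have h1 : AEStronglyMeasurable (fun x : ℝ => ((1 + |x| : ℝ) : ℂ)) volume := by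
    apply Continuous.aestronglyMeasurable; fun_prop
  have := hf.aestronglyMeasurable.mul h1
  refine this.congr (Eventually.of_forall fun x => ?_)
  have : ((1 + |x| : ℝ) : ℂ) ≠ 0 := by exact_mod_cast (one_add_abs_pos x).ne'
  simp only [Pi.mul_apply, Complex.ofReal_inv]
  field_simp

theorem measurable_inv_sub (z : ℂ) : Measurable fun x : ℝ => ((x : ℂ) - z)⁻¹ := by fun_prop

theorem Adm.integrable_div {f : ℝ → ℂ} (hf : Adm f) {z : ℂ} (hz : z.im ≠ 0) :
    Integrable fun x : ℝ => f x / (x - z) := by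
  obtain ⟨C, hC, h⟩ := exists_bound_inv_sub hz
  have hz' := h z (Metric.mem_ball_self (by have := abs_pos.2 hz; positivity))
  refine (hf.norm.const_mul C).mono'
    (by
      simp only [div_eq_mul_inv]
      exact (aestronglyMeasurable_of_adm hf).mul (measurable_inv_sub z).aestronglyMeasurable)
    (Eventually.of_forall fun x => ?_)
  have := (hz' x).2
  rw [div_eq_mul_inv, norm_mul, norm_mul, Complex.norm_real, Real.norm_of_nonneg (by positivity)]
  calc _ ≤ ‖f x‖ * (C * (1 + |x|)⁻¹) := by gcongr
    _ = _ := by ring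

theorem differentiableAt_cauchyTransform {f : ℝ → ℂ} (hf : Adm f) {z₀ : ℂ} (hz : z₀.im ≠ 0) :
    DifferentiableAt ℂ (cauchyTransform f) z₀ := by
  obtain ⟨C, hC, h⟩ := exists_bound_inv_sub hz
  have hpos : 0 < |z₀.im| / 2 := by have := abs_pos.2 hz; positivity
  have hm := aestronglyMeasurable_of_adm hf
  refine (hasDerivAt_integral_of_dominated_loc_of_deriv_le (μ := volume)
    (F := fun z (x : ℝ) => f x / (x - z)) (F' := fun z (x : ℝ) => f x / (x - z) ^ 2)
    (bound := fun x => ‖f x * (((1 + |x|)⁻¹ : ℝ) : ℂ)‖ * C ^ 2)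
    (Metric.ball_mem_nhds z₀ hpos) (Eventually.of_forall fun z => ?_)
    (hf.integrable_div hz) ?_ (Eventually.of_forall fun x z hx => ?_) (hf.norm.mul_const _)
    (Eventually.of_forall fun x z hx => ?_)).2.differentiableAt
  · simp only [div_eq_mul_inv]
    exact hm.mul (measurable_inv_sub z).aestronglyMeasurable
  · simp only [div_eq_mul_inv, ← inv_pow]
    exact hm.mul ((measurable_inv_sub z₀).pow_const 2).aestronglyMeasurable
  · have h1 := (h z hx x).2
    have h2 : (1 + |x|)⁻¹ ≤ 1 := inv_le_one_of_one_le₀ (by linarith [abs_nonneg x])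
    have h3 : 0 ≤ (1 + |x|)⁻¹ := by positivity
    rw [div_eq_mul_inv, ← inv_pow, norm_mul, norm_mul, norm_pow, Complex.norm_real,
      Real.norm_of_nonneg h3, mul_assoc]
    gcongr
    calc ‖((x : ℂ) - z)⁻¹‖ ^ 2 ≤ (C * (1 + |x|)⁻¹) ^ 2 := by gcongr
      _ = (1 + |x|)⁻¹ * ((1 + |x|)⁻¹ * C ^ 2) := by ring
      _ ≤ (1 + |x|)⁻¹ * (1 * C ^ 2) := by gcongr
      _ = _ := by ring
  · have hne := sub_ofReal_ne_zero (h z hx x).1 x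
    have h1 : HasDerivAt (fun z : ℂ => (x : ℂ) - z) (-1) z := by
      simpa using (hasDerivAt_id z).const_sub (x : ℂ)
    have := (h1.inv hne).const_mul (f x)
    simpa [div_eq_mul_inv] using this

theorem Adm.add {f g : ℝ → ℂ} (hf : Adm f) (hg : Adm g) : Adm (fun x => f x + g x) := by
  have := Integrable.add hf hg
  refine this.congr (Eventually.of_forall fun x => ?_)
  simp [add_mul]

theorem Adm.const_mul {f : ℝ → ℂ} (hf : Adm f) (c : ℂ) : Adm (fun x => c * f x) := by
  have := Integrable.const_mul hf c
  refine this.congr (Eventually.of_forall fun x => ?_)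
  simp [mul_assoc]

theorem Adm.mono {f g : ℝ → ℂ} (hf : Adm f) (hg : AEStronglyMeasurable g)
    (h : ∀ x, ‖g x‖ ≤ ‖f x‖) : Adm g := by
  refine Integrable.mono hf (hg.mul ?_) (Eventually.of_forall fun x => ?_)
  · exact Measurable.aestronglyMeasurable (by fun_prop)
  · rw [norm_mul, norm_mul]; gcongr; exact h x

theorem adm_of_integrable {f : ℝ → ℂ} (hf : Integrable f) : Adm f := by
  refine Integrable.mono hf (hf.aestronglyMeasurable.mul ?_) (Eventually.of_forall fun x => ?_)
  · exact Measurable.aestronglyMeasurable (by fun_prop)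
  · rw [norm_mul, Complex.norm_real, Real.norm_of_nonneg (by positivity)]
    exact mul_le_of_le_one_right (norm_nonneg _)
      (inv_le_one_of_one_le₀ (by linarith [abs_nonneg x]))

theorem memLp_inv_one_add_abs : MemLp (fun x : ℝ => (((1 + |x|)⁻¹ : ℝ) : ℂ)) 2 := by
  rw [memLp_two_iff_integrable_sq_norm (Measurable.aestronglyMeasurable (by fun_prop))]
  refine integrable_inv_one_add_sq.mono' (Measurable.aestronglyMeasurable (by fun_prop))
    (Eventually.of_forall fun x => ?_)
  rw [Complex.norm_real, norm_pow, norm_norm, Real.norm_of_nonneg (by positivity), inv_pow]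
  gcongr
  nlinarith [abs_nonneg x, sq_abs x]

theorem adm_of_memLp {f : ℝ → ℂ} (hf : MemLp f 2) : Adm f :=
  hf.integrable_mul memLp_inv_one_add_abs

theorem adm_L2 (f : L2) : Adm f := adm_of_memLp (Lp.memLp f)

theorem memLp_inv_sub {z : ℂ} (hz : z.im ≠ 0) : MemLp (fun x : ℝ => ((x : ℂ) - z)⁻¹) 2 := by
  obtain ⟨C, hC, h⟩ := exists_bound_inv_sub hz
  have hz' := h z (Metric.mem_ball_self (by have := abs_pos.2 hz; positivity))
  refine (memLp_inv_one_add_abs.const_mul (C : ℂ)).of_le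
    (measurable_inv_sub z).aestronglyMeasurable (Eventually.of_forall fun x => ?_)
  rw [norm_mul, Complex.norm_real, Complex.norm_real, Real.norm_of_nonneg hC.le,
    Real.norm_of_nonneg (by positivity)]
  exact (hz' x).2

theorem cauchyTransform_add {f g : ℝ → ℂ} (hf : Adm f) (hg : Adm g) {z : ℂ} (hz : z.im ≠ 0) :
    cauchyTransform (fun x => f x + g x) z = cauchyTransform f z + cauchyTransform g z := by
  simp only [cauchyTransform, add_div]
  exact integral_add (hf.integrable_div hz) (hg.integrable_div hz)

theorem cauchyTransform_const_mul (f : ℝ → ℂ) (c z : ℂ) :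
    cauchyTransform (fun x => c * f x) z = c * cauchyTransform f z := by
  simp only [cauchyTransform, mul_div_assoc]
  exact integral_const_mul _ _

theorem conj_cauchyTransform (f : ℝ → ℂ) (z : ℂ) :
    starRingEnd ℂ (cauchyTransform f z) =
      cauchyTransform (fun x => starRingEnd ℂ (f x)) (starRingEnd ℂ z) := by
  simp only [cauchyTransform, ← integral_conj]
  simp

theorem norm_cauchyTransform_le {f : ℝ → ℂ} (hf : Integrable f) {z : ℂ} (hz : z.im ≠ 0) :
    ‖cauchyTransform f z‖ ≤ (∫ x, ‖f x‖) / |z.im| := by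
  rw [← integral_div]
  refine norm_integral_le_of_norm_le (hf.norm.div_const _) (Eventually.of_forall fun x => ?_)
  rw [norm_div]
  have := abs_pos.2 hz
  gcongr
  simpa using Complex.abs_im_le_norm ((x : ℂ) - z)

/-! ### The Poisson kernel -/

/-- The Poisson kernel of the upper half-plane. -/
def poisson (z : ℂ) (t : ℝ) : ℝ := z.im / (Real.pi * ((t - z.re) ^ 2 + z.im ^ 2))

theorem poisson_eq {z : ℂ} (hz : z.im ≠ 0) (t : ℝ) :
    (poisson z t : ℂ) = (2 * Real.pi * Complex.I)⁻¹ *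
      (((t : ℂ) - z)⁻¹ - ((t : ℂ) - starRingEnd ℂ z)⁻¹) := by
  have h1 := sub_ofReal_ne_zero hz t
  have h2 : (t : ℂ) - starRingEnd ℂ z ≠ 0 := sub_ofReal_ne_zero (by simpa using hz) t
  have h3 : (Real.pi : ℂ) ≠ 0 := by exact_mod_cast Real.pi_ne_zero
  have h4 : ((t : ℂ) - z) * ((t : ℂ) - starRingEnd ℂ z) =
      (((t - z.re) ^ 2 + z.im ^ 2 : ℝ) : ℂ) := by
    refine Complex.ext ?_ ?_
    · simp [pow_two]
    · simp [pow_two]; ring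
  have h5 : z - starRingEnd ℂ z = 2 * z.im * Complex.I := by
    apply Complex.ext <;> simp; ring
  rw [inv_sub_inv h1 h2, h4, poisson]
  have h6 : (((t - z.re) ^ 2 + z.im ^ 2 : ℝ) : ℂ) ≠ 0 := by
    rw [← h4]; exact mul_ne_zero h1 h2
  rw [show (t : ℂ) - starRingEnd ℂ z - (t - z) = z - starRingEnd ℂ z by ring, h5]
  push_cast at h6 ⊢
  field_simp

theorem poisson_pos {z : ℂ} (hz : z ∈ uhp) (t : ℝ) : 0 < poisson z t := by
  have : 0 < z.im := hz
  unfold poisson; positivity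

theorem measurable_poisson (z : ℂ) : Measurable (poisson z) := by
  unfold poisson; fun_prop

theorem memLp_poisson {z : ℂ} (hz : z.im ≠ 0) : MemLp (fun t => (poisson z t : ℂ)) 2 := by
  simp only [poisson_eq hz]
  exact ((memLp_inv_sub hz).sub (memLp_inv_sub (z := starRingEnd ℂ z) (by simpa using hz))).const_mul _

/-- Partial fractions split the Poisson kernel into two Cauchy kernels at conjugate points. A
density whose transform vanishes in the lower half-plane therefore has Poisson integral equal to its
Cauchy transform divided by 2πi. -/
theorem integral_poisson_mul {f : ℝ → ℂ} (hf : Adm f) {z : ℂ} (hz : z.im ≠ 0) :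
    ∫ t, (poisson z t : ℂ) * f t = (2 * Real.pi * Complex.I)⁻¹ *
      (cauchyTransform f z - cauchyTransform f (starRingEnd ℂ z)) := by
  have hz' : (starRingEnd ℂ z).im ≠ 0 := by simpa using hz
  rw [cauchyTransform, cauchyTransform, ← integral_sub (hf.integrable_div hz)
    (hf.integrable_div hz'), ← integral_const_mul]
  refine integral_congr_ae (Eventually.of_forall fun t => ?_)
  simp only [poisson_eq hz]
  ring

theorem poisson_affine {x y : ℝ} (hy : 0 < y) (s : ℝ) :
    poisson (x + y * Complex.I) (x + y * s) = y⁻¹ * (Real.pi⁻¹ * (1 + s ^ 2)⁻¹) := by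
  simp only [poisson, Complex.add_im, Complex.ofReal_im, Complex.mul_im, Complex.ofReal_re,
    Complex.I_im, Complex.I_re, Complex.add_re, Complex.mul_re, mul_zero, mul_one, sub_zero,
    add_zero, zero_add]
  have : (x + y * s - x) ^ 2 + y ^ 2 = y ^ 2 * (1 + s ^ 2) := by ring
  rw [this]
  have := hy.ne'
  field_simp

/-- Substituting t = x + ys removes the dependence of the kernel on the point and exhibits the
Poisson integral as an average of translates. -/
theorem integral_poisson_smul {E : Type*} [NormedAddCommGroup E] [NormedSpace ℝ E] {x y : ℝ}
    (hy : 0 < y) (f : ℝ → E) :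
    ∫ t, poisson (x + y * Complex.I) t • f t =
      ∫ s : ℝ, (Real.pi⁻¹ * (1 + s ^ 2)⁻¹) • f (x + y * s) := by
  have h1 := integral_add_left_eq_self (μ := volume)
    (fun t => poisson (x + y * Complex.I) t • f t) x
  have h2 := Measure.integral_comp_mul_left
    (fun t => poisson (x + y * Complex.I) (x + t) • f (x + t)) y
  rw [← h1]
  rw [abs_of_pos (inv_pos.2 hy)] at h2
  have h3 : ∀ I : E, I = y • (y⁻¹ • I) := fun I => by rw [smul_smul, mul_inv_cancel₀ hy.ne', one_smul]
  rw [h3 (∫ t, poisson (x + y * Complex.I) (x + t) • f (x + t)), ← h2, ← integral_smul]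
  refine integral_congr_ae (Eventually.of_forall fun s => ?_)
  simp only [poisson_affine hy, smul_smul]
  congr 1
  rw [← mul_assoc, mul_inv_cancel₀ hy.ne', one_mul]

theorem integral_cauchy_density : ∫ s : ℝ, (Real.pi⁻¹ * (1 + s ^ 2)⁻¹) = 1 := by
  rw [integral_const_mul, integral_univ_inv_one_add_sq, inv_mul_cancel₀ Real.pi_ne_zero]

theorem integral_poisson {z : ℂ} (hz : z ∈ uhp) : ∫ t, poisson z t = 1 := by
  have := integral_poisson_smul (x := z.re) (y := z.im) hz (fun _ => (1 : ℝ))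
  simp only [smul_eq_mul, mul_one, Complex.re_add_im] at this
  rw [this, integral_cauchy_density]

theorem integrable_poisson {z : ℂ} (hz : z ∈ uhp) : Integrable (poisson z) := by
  -- A non-integrable function has integral 0 by convention, which contradicts the value 1.
  by_contra h
  have := integral_poisson hz
  rw [integral_undef h] at this
  exact zero_ne_one this

theorem integrable_poisson_ofReal {z : ℂ} (hz : z ∈ uhp) :
    Integrable fun t => (poisson z t : ℂ) := (integrable_poisson hz).ofReal

theorem integral_poisson_ofReal {z : ℂ} (hz : z ∈ uhp) : ∫ t, (poisson z t : ℂ) = 1 := by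
  rw [integral_complex_ofReal, integral_poisson hz, Complex.ofReal_one]

/-! ### Poisson representation of bounded holomorphic functions -/

theorem aestronglyMeasurable_strip {F : ℂ → ℂ} {a b : ℝ}
    (hF : ContinuousOn F {z | a ≤ z.im ∧ z.im ≤ b}) :
    AEStronglyMeasurable (fun p : ℝ × ℝ => F (p.1 + p.2 * Complex.I))
      (volume.prod (volume.restrict (Set.Ioc a b))) := by
  have : (volume.prod (volume.restrict (Set.Ioc a b)) : Measure (ℝ × ℝ)) =
      (volume.prod volume).restrict (Set.univ ×ˢ Set.Ioc a b) := by
    rw [← Measure.prod_restrict, Measure.restrict_univ]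
  rw [this]
  refine ContinuousOn.aestronglyMeasurable ?_ (MeasurableSet.univ.prod measurableSet_Ioc)
  refine hF.comp (Continuous.continuousOn (by fun_prop)) fun p hp => ?_
  have := hp.2
  simpa using ⟨this.1.le, this.2⟩

theorem continuous_line {F : ℂ → ℂ} (hF : DifferentiableOn ℂ F uhp) {y : ℝ} (hy : 0 < y) :
    Continuous fun x : ℝ => F (x + y * Complex.I) :=
  hF.continuousOn.comp_continuous (by fun_prop) fun x => by simpa [uhp] using hy

theorem integrable_inv_one_add_abs_sq : Integrable fun x : ℝ => ((1 + |x|)⁻¹) ^ 2 := by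
  have := (memLp_two_iff_integrable_sq_norm memLp_inv_one_add_abs.1).1 memLp_inv_one_add_abs
  refine this.congr (Eventually.of_forall fun x => ?_)
  simp only [Complex.norm_real, Real.norm_eq_abs, sq_abs]

/-- Far from `z` the difference quotient is at most 2M/|w - z|; near `z` it is bounded by
compactness. Working with `dslope` removes the pole at `z`, so that the contour argument needs no
residue. -/
theorem exists_bound_dslope {L : ℂ → ℂ} {ε M : ℝ} (hε : 0 < ε)
    (hL : DifferentiableOn ℂ L {w | -ε < w.im}) (hM : ∀ w : ℂ, -ε < w.im → ‖L w‖ ≤ M)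
    {z : ℂ} (hz : z ∈ uhp) :
    ∃ C : ℝ, 0 ≤ C ∧ ∀ w : ℂ, 0 ≤ w.im → ‖dslope L z w‖ ≤ C * (1 + |w.re|)⁻¹ := by
  have hz0 : 0 < z.im := hz
  have hopen : IsOpen {w : ℂ | -ε < w.im} := isOpen_lt continuous_const Complex.continuous_im
  have hzmem : {w : ℂ | -ε < w.im} ∈ 𝓝 z := hopen.mem_nhds (by
    simp only [Set.mem_ofPred_eq]; linarith)
  have hd := (Complex.differentiableOn_dslope hzmem).2 hL
  have hM0 : 0 ≤ M := (norm_nonneg _).trans (hM z (by linarith))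
  set r := z.im
  have hsub : Metric.closedBall z r ⊆ {w : ℂ | -ε < w.im} := by
    intro w hw
    rw [Metric.mem_closedBall, dist_eq_norm] at hw
    have := (Complex.abs_im_le_norm (w - z)).trans hw
    simp only [Complex.sub_im] at this
    have := (abs_le.1 this).1
    simp only [Set.mem_ofPred_eq]
    linarith
  obtain ⟨C₁, hC₁⟩ := (isCompact_closedBall z r).exists_bound_of_continuousOn
    (hd.continuousOn.mono hsub)
  have hC₁0 : 0 ≤ C₁ := (norm_nonneg _).trans (hC₁ z (Metric.mem_closedBall_self hz0.le))
  -- The two summands bound |dslope|·(1 + |w - z|) inside and outside the ball of radius r = Im z;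
  -- the factor 1 + |Re z| trades 1 + |w - z| for 1 + |Re w|.
  refine ⟨(C₁ * (1 + r) + 2 * M * (r⁻¹ + 1)) * (1 + |z.re|), by positivity, fun w hw => ?_⟩
  have key : ‖dslope L z w‖ * (1 + ‖w - z‖) ≤ C₁ * (1 + r) + 2 * M * (r⁻¹ + 1) := by
    rcases le_or_gt ‖w - z‖ r with h | h
    · have h1 := hC₁ w (by rwa [Metric.mem_closedBall, dist_eq_norm])
      have : ‖dslope L z w‖ * (1 + ‖w - z‖) ≤ C₁ * (1 + r) := by gcongr
      have : 0 ≤ 2 * M * (r⁻¹ + 1) := by positivity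
      linarith
    · have hp : 0 < ‖w - z‖ := hz0.trans h
      have hne : w ≠ z := fun h => by simp [h] at hp
      rw [dslope_of_ne _ hne, slope_def_module, norm_smul, norm_inv]
      have h2 : ‖L w - L z‖ ≤ 2 * M := by
        have := norm_sub_le (L w) (L z)
        have := hM w (by linarith)
        have := hM z (by linarith)
        linarith
      have : ‖w - z‖⁻¹ * ‖L w - L z‖ * (1 + ‖w - z‖) ≤ 2 * M * (r⁻¹ + 1) := by
        calc ‖w - z‖⁻¹ * ‖L w - L z‖ * (1 + ‖w - z‖)
            = ‖L w - L z‖ * (‖w - z‖⁻¹ + 1) := by field_simp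
          _ ≤ 2 * M * (r⁻¹ + 1) := by gcongr
      have : 0 ≤ C₁ * (1 + r) := by positivity
      linarith
  have h3 : 1 + |w.re| ≤ (1 + |z.re|) * (1 + ‖w - z‖) := by
    have h4 := Complex.abs_re_le_norm (w - z)
    have h5 := abs_sub_abs_le_abs_sub w.re z.re
    simp only [Complex.sub_re] at h4
    nlinarith [abs_nonneg z.re, norm_nonneg (w - z)]
  rw [← div_eq_mul_inv, le_div_iff₀ (one_add_abs_pos _)]
  calc ‖dslope L z w‖ * (1 + |w.re|) ≤ ‖dslope L z w‖ * ((1 + |z.re|) * (1 + ‖w - z‖)) := by gcongr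
    _ = (‖dslope L z w‖ * (1 + ‖w - z‖)) * (1 + |z.re|) := by ring
    _ ≤ _ := by gcongr

theorem norm_inv_sub_conj_le {z : ℂ} (hz : z ∈ uhp) :
    ∃ C : ℝ, 0 < C ∧ ∀ w : ℂ, 0 ≤ w.im →
      ‖(w - starRingEnd ℂ z)⁻¹‖ ≤ C * (1 + |w.re|)⁻¹ := by
  have hz0 : 0 < z.im := hz
  have hz' : (starRingEnd ℂ z).im ≠ 0 := by simpa using hz0.ne'
  obtain ⟨C, hC, h⟩ := exists_bound_inv_sub hz'
  refine ⟨C, hC, fun w hw => ?_⟩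
  have := (h _ (Metric.mem_ball_self (by have := abs_pos.2 hz'; positivity)) w.re).2
  refine le_trans ?_ this
  rw [norm_inv, norm_inv]
  have hne := sub_ofReal_ne_zero hz' w.re
  have hle : ‖(w.re : ℂ) - starRingEnd ℂ z‖ ≤ ‖w - starRingEnd ℂ z‖ := by
    rw [← sq_le_sq₀ (norm_nonneg _) (norm_nonneg _), ← Complex.normSq_eq_norm_sq,
      ← Complex.normSq_eq_norm_sq, Complex.normSq_apply, Complex.normSq_apply]
    simp only [Complex.sub_re, Complex.ofReal_re, Complex.conj_re, Complex.sub_im,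
      Complex.ofReal_im, Complex.conj_im]
    nlinarith
  have := norm_pos_iff.2 hne
  gcongr

/-- Poisson representation of bounded holomorphic functions. -/
theorem integral_poisson_bounded {K : ℂ → ℂ} {M ε : ℝ} (hK : DifferentiableOn ℂ K uhp)
    (hM : ∀ z ∈ uhp, ‖K z‖ ≤ M) (hε : 0 < ε) {z : ℂ} (hz : z ∈ uhp) :
    ∫ t : ℝ, (poisson z t : ℂ) * K (t + ε * Complex.I) = K (z + ε * Complex.I) := by
  have hz0 : 0 < z.im := hz
  -- The shift by ε makes the function holomorphic across the real line.
  set L : ℂ → ℂ := fun w => K (w + ε * Complex.I) with hLdef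
  have hL : DifferentiableOn ℂ L {w | -ε < w.im} :=
    hK.comp (by fun_prop) fun w hw => by
      simp only [Set.mem_ofPred_eq] at hw
      simp only [uhp, Set.mem_ofPred_eq, Complex.add_im, Complex.mul_im, Complex.ofReal_re,
        Complex.I_im, Complex.ofReal_im, Complex.I_re]
      linarith
  have hLM : ∀ w : ℂ, -ε < w.im → ‖L w‖ ≤ M := fun w hw => hM _ (by
    simp only [uhp, Set.mem_ofPred_eq, Complex.add_im, Complex.mul_im, Complex.ofReal_re,
        Complex.I_im, Complex.ofReal_im, Complex.I_re]
    linarith)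
  obtain ⟨C₁, hC₁, h1⟩ := exists_bound_dslope hε hL hLM hz
  obtain ⟨C₂, hC₂, h2⟩ := norm_inv_sub_conj_le hz
  have hopen : IsOpen {w : ℂ | -ε < w.im} := isOpen_lt continuous_const Complex.continuous_im
  have hzmem : {w : ℂ | -ε < w.im} ∈ 𝓝 z := hopen.mem_nhds (by
    simp only [Set.mem_ofPred_eq]; linarith)
  have hd := (Complex.differentiableOn_dslope hzmem).2 hL
  -- Since the Poisson kernel is (Im z/π)/((t - z)(t - conj z)), its product with L(t) - L(z) is (Im
  -- z/π)F(t). `F` is holomorphic with a quadratic bound uniform in the height, so its integral over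
  -- horizontal lines is constant; letting the height tend to infinity shows that it is 0.
  set F : ℂ → ℂ := fun w => dslope L z w * (w - starRingEnd ℂ z)⁻¹ with hF
  have hFd : DifferentiableOn ℂ F {w | 0 ≤ w.im} := by
    refine (hd.mono fun w hw => ?_).mul (DifferentiableOn.inv (by fun_prop) fun w hw h => ?_)
    · simp only [Set.mem_ofPred_eq] at hw ⊢; linarith
    · have := congrArg Complex.im h
      simp only [Complex.sub_im, Complex.conj_im, Complex.zero_im] at this
      simp only [Set.mem_ofPred_eq] at hw
      linarith
  have hFb : ∀ x y : ℝ, 0 ≤ y → ‖F (x + y * Complex.I)‖ ≤ C₁ * C₂ * ((1 + |x|)⁻¹) ^ 2 := by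
    intro x y hy
    have h1' := h1 (x + y * Complex.I) (by simpa using hy)
    have h2' := h2 (x + y * Complex.I) (by simpa using hy)
    simp only [Complex.add_re, Complex.ofReal_re, Complex.mul_re, Complex.I_re, mul_zero,
      Complex.ofReal_im, Complex.I_im, mul_one, sub_zero, add_zero] at h1' h2'
    rw [hF, norm_mul]
    calc _ ≤ (C₁ * (1 + |x|)⁻¹) * (C₂ * (1 + |x|)⁻¹) := by gcongr
      _ = _ := by ring
  have hg : Integrable fun x : ℝ => C₁ * C₂ * ((1 + |x|)⁻¹) ^ 2 :=
    integrable_inv_one_add_abs_sq.const_mul _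
  have hcont : ∀ y : ℝ, 0 ≤ y → Continuous fun x : ℝ => F (x + y * Complex.I) := fun y hy =>
    hFd.continuousOn.comp_continuous (by fun_prop) fun x => by simpa using hy
  have hint : ∀ y : ℝ, 0 ≤ y → Integrable fun x : ℝ => F (x + y * Complex.I) := fun y hy =>
    hg.mono' (hcont y hy).aestronglyMeasurable (Eventually.of_forall fun x => hFb x y hy)
  have hJ : ∀ Y : ℝ, 0 ≤ Y →
      ∫ x : ℝ, F (x + (0 : ℝ) * Complex.I) = ∫ x : ℝ, F (x + Y * Complex.I) := by
    intro Y hY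
    have hFs : DifferentiableOn ℂ F {w | 0 ≤ w.im ∧ w.im ≤ Y} := hFd.mono fun w hw => hw.1
    refine integral_line_eq_of_integrable_strip hY hFs (hint 0 le_rfl) (hint Y hY) ?_
    have hg2 : Integrable (fun p : ℝ × ℝ => C₁ * C₂ * ((1 + |p.1|)⁻¹) ^ 2)
        (volume.prod (volume.restrict (Set.Ioc 0 Y))) := hg.comp_fst _
    have hae : ∀ᵐ p : ℝ × ℝ ∂(volume.prod (volume.restrict (Set.Ioc 0 Y))), p.2 ∈ Set.Ioc 0 Y :=
      Measure.quasiMeasurePreserving_snd.ae (ae_restrict_mem measurableSet_Ioc)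
    refine hg2.mono' (aestronglyMeasurable_strip hFs.continuousOn) ?_
    filter_upwards [hae] with p hp
    exact hFb _ _ hp.1.le
  have hlim : Tendsto (fun Y : ℝ => ∫ x : ℝ, F (x + Y * Complex.I)) atTop (𝓝 (∫ _ : ℝ, (0 : ℂ))) := by
    refine tendsto_integral_filter_of_dominated_convergence _
      (eventually_ge_atTop 0 |>.mono fun y hy => (hcont y hy).aestronglyMeasurable)
      (eventually_ge_atTop 0 |>.mono fun y hy => Eventually.of_forall fun x => hFb x y hy) hg
      (Eventually.of_forall fun x => ?_)
    refine squeeze_zero_norm' (a := fun Y : ℝ => C₁ * Y⁻¹) ?_ ?_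
    · filter_upwards [eventually_gt_atTop 0] with Y hY
      have h1' := h1 (x + Y * Complex.I) (by simpa using hY.le)
      rw [hF, norm_mul]
      have h5 : ‖((x + Y * Complex.I : ℂ) - starRingEnd ℂ z)⁻¹‖ ≤ Y⁻¹ := by
        rw [norm_inv]
        gcongr
        have := (le_abs_self _).trans (Complex.abs_im_le_norm ((x + Y * Complex.I : ℂ) - starRingEnd ℂ z))
        simp only [Complex.sub_im, Complex.add_im, Complex.ofReal_im, Complex.mul_im,
          Complex.ofReal_re, Complex.I_im, Complex.I_re, Complex.conj_im] at this
        linarith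
      have h6 : ‖dslope L z (x + Y * Complex.I)‖ ≤ C₁ := by
        refine h1'.trans (mul_le_of_le_one_right hC₁ (inv_le_one_of_one_le₀ ?_))
        linarith [abs_nonneg (x + Y * Complex.I : ℂ).re]
      gcongr
    · simpa using tendsto_inv_atTop_zero.const_mul C₁
  have h0 : ∫ x : ℝ, F (x + (0 : ℝ) * Complex.I) = 0 := by
    have h7 : Tendsto (fun Y : ℝ => ∫ x : ℝ, F (x + Y * Complex.I)) atTop
        (𝓝 (∫ x : ℝ, F (x + (0 : ℝ) * Complex.I))) :=
      tendsto_const_nhds.congr' (eventually_ge_atTop 0 |>.mono fun y hy => hJ y hy)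
    simpa using tendsto_nhds_unique h7 hlim
  have hpt : ∀ t : ℝ, (poisson z t : ℂ) * K (t + ε * Complex.I) =
      (z.im / Real.pi : ℂ) * F (t + (0 : ℝ) * Complex.I) + (poisson z t : ℂ) * L z := by
    intro t
    have hne : (t : ℂ) ≠ z := fun h => sub_ofReal_ne_zero hz0.ne' t (sub_eq_zero.2 h)
    have hne1 := sub_ofReal_ne_zero hz0.ne' t
    have hne2 : (t : ℂ) - starRingEnd ℂ z ≠ 0 := sub_ofReal_ne_zero (by simpa using hz0.ne') t
    have hpi : (Real.pi : ℂ) ≠ 0 := by exact_mod_cast Real.pi_ne_zero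
    have h5 : z - starRingEnd ℂ z = 2 * z.im * Complex.I := by
      apply Complex.ext <;> simp; ring
    simp only [hF, Complex.ofReal_zero, zero_mul, add_zero]
    rw [dslope_of_ne _ hne, slope_def_module, poisson_eq hz0.ne', smul_eq_mul, inv_sub_inv hne1 hne2,
      show (t : ℂ) - starRingEnd ℂ z - (t - z) = z - starRingEnd ℂ z by ring, h5]
    simp only [hLdef]
    field_simp
    ring
  have hP := integrable_poisson_ofReal hz
  have e1 := (integral_congr_ae (Eventually.of_forall hpt)).trans
    (integral_add ((hint 0 le_rfl).const_mul (z.im / Real.pi : ℂ)) (hP.mul_const (L z)))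
  rw [e1, integral_const_mul, h0, integral_mul_const, integral_poisson_ofReal hz]
  simp [hLdef]

/-! ### Vanishing of the Cauchy transform of H₂⁺ below the real line -/

theorem lintegral_enorm_mul_le {f g : ℝ → ℂ} (hf : AEStronglyMeasurable f)
    (hg : AEStronglyMeasurable g) : ∫⁻ x, ‖f x * g x‖ₑ ≤ eLpNorm f 2 * eLpNorm g 2 := by
  have h := eLpNorm_smul_le_mul_eLpNorm (p := 2) (q := 2) (r := 1) (μ := (volume : Measure ℝ)) hg hf
  rwa [eLpNorm_one_eq_lintegral_enorm] at h

theorem enorm_integral_mul_le {f g : ℝ → ℂ} (hf : AEStronglyMeasurable f)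
    (hg : AEStronglyMeasurable g) : ‖∫ x, f x * g x‖ₑ ≤ eLpNorm f 2 * eLpNorm g 2 :=
  (enorm_integral_le_lintegral_enorm _).trans (lintegral_enorm_mul_le hf hg)

theorem eLpNorm_inv_sub {z : ℂ} (hz : z.im ≠ 0) :
    eLpNorm (fun x : ℝ => ((x : ℂ) - z)⁻¹) 2 = ENNReal.ofReal ((Real.pi / |z.im|) ^ (2 : ℝ)⁻¹) := by
  rw [(memLp_inv_sub hz).eLpNorm_eq_integral_rpow_norm (by simp) (by simp)]
  simp only [ENNReal.toReal_ofNat, Real.rpow_ofNat]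
  congr 2
  -- Reflecting `z` into the upper half-plane makes |x - z|⁻² equal to π/|Im z| times the Poisson
  -- kernel, whose integral is 1.
  set w : ℂ := z.re + |z.im| * Complex.I with hw
  have hwu : w ∈ uhp := by simpa [uhp, hw] using hz
  have := integral_poisson hwu
  have h2 : ∀ x : ℝ, ‖((x : ℂ) - z)⁻¹‖ ^ 2 = Real.pi / |z.im| * poisson w x := by
    intro x
    have hp := abs_pos.2 hz
    rw [norm_inv, inv_pow, ← Complex.normSq_eq_norm_sq, Complex.normSq_apply]
    simp only [poisson, hw, Complex.add_im, Complex.ofReal_im, Complex.mul_im, Complex.ofReal_re,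
      Complex.I_im, Complex.I_re, Complex.add_re, Complex.mul_re, mul_zero, mul_one, sub_zero,
      add_zero, zero_add, Complex.sub_re, Complex.sub_im, sq_abs]
    have h3 : (x - z.re) ^ 2 + z.im ^ 2 ≠ 0 := by positivity
    have h4 : (x - z.re) * (x - z.re) + (0 - z.im) * (0 - z.im) = (x - z.re) ^ 2 + z.im ^ 2 := by
      ring
    rw [h4]
    have := Real.pi_ne_zero
    field_simp
  simp_rw [h2]
  rw [integral_const_mul, this, mul_one]

/-- The pole ζ + iy lies below the line of integration, so the contour can be pushed up to any
height Y. There Cauchy–Schwarz bounds the integral by C(π/|Im ζ + y - Y|)^(1/2), which tends to 0.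
-/
theorem integral_mul_inv_sub_eq_zero {F : ℂ → ℂ} (hF : DifferentiableOn ℂ F uhp) {C : NNReal}
    (hC : ∀ y : ℝ, 0 < y → eLpNorm (fun x : ℝ => F (x + y * Complex.I)) 2 volume ≤ C)
    {y : ℝ} (hy : 0 < y) {ζ : ℂ} (hζ : ζ.im < 0) :
    ∫ x : ℝ, F (x + y * Complex.I) * ((x : ℂ) - ζ)⁻¹ = 0 := by
  set G : ℂ → ℂ := fun w => F w * (w - (ζ + y * Complex.I))⁻¹ with hG
  have hGd : DifferentiableOn ℂ G {w | y ≤ w.im} := by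
    refine (hF.mono fun w hw => hy.trans_le hw).mul
      (DifferentiableOn.inv (by fun_prop) fun w hw h => ?_)
    have := congrArg Complex.im h
    simp only [Complex.sub_im, Complex.add_im, Complex.mul_im, Complex.ofReal_re, Complex.I_im,
      Complex.ofReal_im, Complex.I_re, Complex.zero_im] at this
    have hw : y ≤ w.im := hw
    linarith
  have him : ∀ Y : ℝ, (ζ + (y - Y) * Complex.I).im = ζ.im + (y - Y) := fun Y => by simp
  have hline : ∀ x Y : ℝ, G (x + Y * Complex.I) =
      F (x + Y * Complex.I) * ((x : ℂ) - (ζ + (y - Y) * Complex.I))⁻¹ := by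
    intro x Y
    simp only [hG]; congr 2; ring
  have hmem : ∀ Y : ℝ, y ≤ Y → MemLp (fun x : ℝ => F (x + Y * Complex.I)) 2 := fun Y hY =>
    ⟨(continuous_line hF (hy.trans_le hY)).aestronglyMeasurable,
      (hC Y (hy.trans_le hY)).trans_lt ENNReal.coe_lt_top⟩
  have hne : ∀ Y : ℝ, y ≤ Y → (ζ + (y - Y) * Complex.I).im ≠ 0 := fun Y hY => by
    rw [him]; linarith
  have hbd : ∀ Y : ℝ, y ≤ Y → ∫⁻ x : ℝ, ‖G (x + Y * Complex.I)‖ₑ ≤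
      C * ENNReal.ofReal ((Real.pi / |ζ.im + (y - Y)|) ^ (2 : ℝ)⁻¹) := by
    intro Y hY
    simp_rw [hline]
    refine (lintegral_enorm_mul_le (hmem Y hY).1 (memLp_inv_sub (hne Y hY)).1).trans ?_
    rw [eLpNorm_inv_sub (hne Y hY), him]
    gcongr
    exact hC Y (hy.trans_le hY)
  have hint : ∀ Y : ℝ, y ≤ Y → Integrable fun x : ℝ => G (x + Y * Complex.I) := by
    intro Y hY
    simp_rw [hline]
    exact (hmem Y hY).integrable_mul (memLp_inv_sub (hne Y hY))
  have hJ : ∀ Y : ℝ, y ≤ Y →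
      ∫ x : ℝ, G (x + y * Complex.I) = ∫ x : ℝ, G (x + Y * Complex.I) := by
    intro Y hY
    have hGs : DifferentiableOn ℂ G {w | y ≤ w.im ∧ w.im ≤ Y} := hGd.mono fun w hw => hw.1
    have hm := aestronglyMeasurable_strip hGs.continuousOn
    refine integral_line_eq_of_integrable_strip hY hGs (hint y le_rfl) (hint Y hY) ⟨hm, ?_⟩
    rw [hasFiniteIntegral_iff_enorm, lintegral_prod_symm _ hm.enorm]
    calc ∫⁻ s in Set.Ioc y Y, ∫⁻ x : ℝ, ‖G (x + s * Complex.I)‖ₑ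
        ≤ ∫⁻ s in Set.Ioc y Y, C * ENNReal.ofReal ((Real.pi / |ζ.im|) ^ (2 : ℝ)⁻¹) := by
          refine setLIntegral_mono measurable_const fun s hs => (hbd s hs.1.le).trans ?_
          have h1 : 0 < |ζ.im| := abs_pos.2 hζ.ne
          have h2 : |ζ.im| ≤ |ζ.im + (y - s)| := by
            rw [abs_of_neg hζ, abs_of_neg (by linarith [hs.1])]; linarith [hs.1]
          gcongr
      _ < ⊤ := by
          rw [setLIntegral_const]
          exact ENNReal.mul_lt_top (ENNReal.mul_lt_top ENNReal.coe_lt_top ENNReal.ofReal_lt_top)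
            measure_Ioc_lt_top
  have hlim : Tendsto (fun Y : ℝ => (C : ENNReal) *
      ENNReal.ofReal ((Real.pi / |ζ.im + (y - Y)|) ^ (2 : ℝ)⁻¹)) atTop (𝓝 0) := by
    have h1 : Tendsto (fun Y : ℝ => ζ.im + (y - Y)) atTop atBot :=
      tendsto_atBot_add_const_left _ _ (tendsto_atBot_add_const_left _ _ tendsto_neg_atTop_atBot)
    have h2 := (tendsto_abs_atBot_atTop.comp h1).const_div_atTop Real.pi
    have h3 := h2.rpow_const (p := (2 : ℝ)⁻¹) (Or.inr (by norm_num))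
    rw [Real.zero_rpow (by norm_num)] at h3
    have h4 := ENNReal.Tendsto.const_mul (ENNReal.tendsto_ofReal h3)
      (Or.inr (ENNReal.coe_ne_top (r := C)))
    simpa using h4
  have h0 : ∫ x : ℝ, G (x + y * Complex.I) = 0 := by
    rw [← enorm_eq_zero, ← nonpos_iff_eq_zero]
    refine ge_of_tendsto hlim ?_
    filter_upwards [eventually_ge_atTop y] with Y hY
    rw [hJ Y hY]
    exact (enorm_integral_le_lintegral_enorm _).trans (hbd Y hY)
  simpa [hline] using h0

/-- The Cauchy transform of a function in `H₂⁺` vanishes in the lower half-plane. -/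
theorem cauchyTransform_eq_zero_of_hardyPlus {f : L2} (hf : f ∈ hardyPlus) {ζ : ℂ}
    (hζ : ζ.im < 0) : cauchyTransform f ζ = 0 := by
  obtain ⟨F, hF, ⟨C, hC⟩, hlim⟩ := hf
  have hζ' := memLp_inv_sub hζ.ne
  have hf2 := Lp.memLp f
  -- As the integral of F(x + iy)/(x - ζ) vanishes, the transform of `f` is, up to sign, that of F(·
  -- + iy) - f, which is small in L².
  have hle : ∀ y : ℝ, 0 < y → ‖cauchyTransform f ζ‖ₑ ≤
      eLpNorm (fun x : ℝ => F (x + y * Complex.I) - f x) 2 volume *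
        eLpNorm (fun x : ℝ => ((x : ℂ) - ζ)⁻¹) 2 := by
    intro y hy
    have hFy : MemLp (fun x : ℝ => F (x + y * Complex.I)) 2 :=
      ⟨(continuous_line hF hy).aestronglyMeasurable, (hC y hy).trans_lt ENNReal.coe_lt_top⟩
    have h1 : ∫ x : ℝ, (F (x + y * Complex.I) - f x) * ((x : ℂ) - ζ)⁻¹ = -cauchyTransform f ζ := by
      simp only [sub_mul]
      have := integral_sub (hFy.integrable_mul hζ') (hf2.integrable_mul hζ')
      simp only [Pi.mul_apply] at this
      rw [this, integral_mul_inv_sub_eq_zero hF hC hy hζ, zero_sub]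
      simp only [cauchyTransform, div_eq_mul_inv]
    rw [← enorm_neg, ← h1]
    exact enorm_integral_mul_le (hFy.sub hf2).1 hζ'.1
  have hlim2 := ENNReal.Tendsto.mul_const hlim (Or.inr hζ'.eLpNorm_ne_top)
  rw [zero_mul] at hlim2
  rw [← enorm_eq_zero, ← nonpos_iff_eq_zero]
  exact ge_of_tendsto hlim2 (eventually_nhdsWithin_of_forall fun y hy => hle y hy)

/-! ### Fatou's theorem for Poisson integrals -/

theorem exists_dyadic_majorant (s : ℝ) :
    ∃ n : ℕ, s ≤ 2 ^ n ∧ (1 + s ^ 2)⁻¹ ≤ 4 * (4⁻¹ : ℝ) ^ n := by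
  rcases le_or_gt s 1 with h | h
  · refine ⟨0, by simpa using h, ?_⟩
    have : (1 + s ^ 2)⁻¹ ≤ 1 := inv_le_one_of_one_le₀ (by nlinarith)
    simp only [pow_zero]; linarith
  · obtain ⟨n, hn1, hn2⟩ := exists_nat_pow_near h.le (by norm_num : (1 : ℝ) < 2)
    refine ⟨n + 1, hn2.le, ?_⟩
    have h4 : (4 : ℝ) ^ n ≤ 1 + s ^ 2 := by
      have : ((2 : ℝ) ^ n) ^ 2 ≤ s ^ 2 := by gcongr
      rw [← pow_mul, mul_comm, pow_mul] at this
      norm_num at this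
      linarith
    calc (1 + s ^ 2)⁻¹ ≤ ((4 : ℝ) ^ n)⁻¹ := by gcongr
      _ = 4 * (4⁻¹ : ℝ) ^ (n + 1) := by rw [pow_succ, inv_pow]; ring

theorem poisson_vertical {k ε : ℝ} (hε : 0 < ε) (t : ℝ) :
    poisson (k + ε * Complex.I) t = (Real.pi * ε)⁻¹ * (1 + (|t - k| / ε) ^ 2)⁻¹ := by
  simp only [poisson, Complex.add_im, Complex.ofReal_im, Complex.mul_im, Complex.ofReal_re,
    Complex.I_im, Complex.I_re, Complex.add_re, Complex.mul_re, mul_zero, mul_one, sub_zero,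
    add_zero, zero_add]
  rw [div_pow, sq_abs]
  have := Real.pi_ne_zero
  have h : (t - k) ^ 2 + ε ^ 2 ≠ 0 := by positivity
  have h' : 1 + (t - k) ^ 2 / ε ^ 2 ≠ 0 := by positivity
  field_simp
  ring

/-- Every `t` lies in some dyadic ball on which the kernel is at most the matching coefficient, and
that single term of the series already dominates. This reduces Poisson integrals to averages over
centred balls. -/
theorem lintegral_poisson_le {k ε : ℝ} (hε : 0 < ε) {h : ℝ → ENNReal} (hm : AEMeasurable h) :
    ∫⁻ t, ENNReal.ofReal (poisson (k + ε * Complex.I) t) * h t ≤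
      ∑' n : ℕ, ENNReal.ofReal ((Real.pi * ε)⁻¹ * (4 * (4⁻¹ : ℝ) ^ n)) *
        ∫⁻ t in Metric.closedBall k (2 ^ n * ε), h t := by
  have hmeas : ∀ n : ℕ, MeasurableSet (Metric.closedBall k (2 ^ n * ε)) :=
    fun n => Metric.isClosed_closedBall.measurableSet
  calc ∫⁻ t, ENNReal.ofReal (poisson (k + ε * Complex.I) t) * h t
      ≤ ∫⁻ t, ∑' n : ℕ, ENNReal.ofReal ((Real.pi * ε)⁻¹ * (4 * (4⁻¹ : ℝ) ^ n)) *
          (Metric.closedBall k (2 ^ n * ε)).indicator h t := by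
        refine lintegral_mono fun t => ?_
        obtain ⟨n, hn1, hn2⟩ := exists_dyadic_majorant (|t - k| / ε)
        refine le_trans ?_ (ENNReal.le_tsum n)
        have : t ∈ Metric.closedBall k (2 ^ n * ε) := by
          rw [Metric.mem_closedBall, Real.dist_eq]
          rwa [div_le_iff₀ hε] at hn1
        rw [Set.indicator_of_mem this, poisson_vertical hε]
        gcongr
    _ = _ := by
        rw [lintegral_tsum fun n => (hm.indicator (hmeas n)).const_mul _]
        congr 1; ext n
        rw [lintegral_const_mul'' _ (hm.indicator (hmeas n)), lintegral_indicator (hmeas n)]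

/-- Fatou's theorem for Poisson integrals of square integrable functions. -/
theorem ae_tendsto_poisson_integral {f : ℝ → ℂ} (hf : MemLp f 2) :
    ∀ᵐ k : ℝ, Tendsto (fun ε : ℝ => ∫ t, (poisson (k + ε * Complex.I) t : ℂ) * f t)
      (𝓝[>] 0) (𝓝 (f k)) := by
  have hloc : LocallyIntegrable f := hf.locallyIntegrable (by norm_num)
  have hsq : Integrable fun t => ‖f t‖ ^ 2 := (memLp_two_iff_integrable_sq_norm hf.1).1 hf
  filter_upwards [IsUnifLocDoublingMeasure.ae_tendsto_average_norm_sub volume hloc 1] with k hk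
  set Φ : ℝ → ℝ := fun r => ∫ t in Metric.closedBall k r, ‖f t - f k‖ with hΦ
  have hI : ∀ r, IntegrableOn (fun t => ‖f t - f k‖) (Metric.closedBall k r) := fun r =>
    ((hloc.sub (locallyIntegrable_const (f k))).integrableOn_isCompact
      (isCompact_closedBall k r)).norm
  have hA : Tendsto (fun r : ℝ => Φ r / (2 * r)) (𝓝[>] 0) (𝓝 0) := by
    have := hk (fun _ : ℝ => k) id (l := 𝓝[>] 0) tendsto_id
      (eventually_nhdsWithin_of_forall fun r hr => by simpa using (le_of_lt hr))
    refine this.congr' (eventually_nhdsWithin_of_forall fun r hr => ?_)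
    have hr' : (0 : ℝ) ≤ 2 * r := by have : 0 < r := hr; positivity
    rw [setAverage_eq, measureReal_def, id, Real.volume_closedBall, ENNReal.toReal_ofReal hr',
      smul_eq_mul]
    exact (div_eq_inv_mul _ _).symm
  have hΦ0 : ∀ r, 0 ≤ Φ r := fun r => integral_nonneg fun t => norm_nonneg _
  -- The radii 2ⁿε are unbounded for fixed ε, so the averages must be bounded for all radii: small
  -- ones by convergence at the Lebesgue point, large ones from |f| ≤ |f|² + 1 and square
  -- integrability.
  obtain ⟨C, hC⟩ : ∃ C : ℝ, ∀ r : ℝ, 0 < r → Φ r / (2 * r) ≤ C := by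
    obtain ⟨r₀, hr₀, h1⟩ := mem_nhdsGT_iff_exists_Ioo_subset.1 (hA.eventually_le_const zero_lt_one)
    have hr₀ : 0 < r₀ := hr₀
    set S := ∫ t, ‖f t‖ ^ 2
    have hS : 0 ≤ S := integral_nonneg fun t => by positivity
    refine ⟨1 + ‖f k‖ + S / (2 * r₀), fun r hr => ?_⟩
    rcases lt_or_ge r r₀ with h | h
    · have h1 : Φ r / (2 * r) ≤ 1 := h1 ⟨hr, h⟩
      have : 0 ≤ ‖f k‖ + S / (2 * r₀) := by positivity
      linarith
    · have h2 : Φ r ≤ ∫ t in Metric.closedBall k r, (‖f t‖ ^ 2 + (1 + ‖f k‖)) := by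
        have hc : IntegrableOn (fun _ : ℝ => 1 + ‖f k‖) (Metric.closedBall k r) :=
          (locallyIntegrable_const _).integrableOn_isCompact (isCompact_closedBall k r)
        refine integral_mono (hI r) (hsq.integrableOn.add hc) fun t => ?_
        have := norm_sub_le (f t) (f k)
        nlinarith [sq_nonneg (‖f t‖ - 1), norm_nonneg (f t)]
      have hc : IntegrableOn (fun _ : ℝ => 1 + ‖f k‖) (Metric.closedBall k r) :=
          (locallyIntegrable_const _).integrableOn_isCompact (isCompact_closedBall k r)
      rw [integral_add hsq.integrableOn hc, setIntegral_const, measureReal_def,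
        Real.volume_closedBall, ENNReal.toReal_ofReal (by positivity), smul_eq_mul] at h2
      have h3 : ∫ t in Metric.closedBall k r, ‖f t‖ ^ 2 ≤ S :=
        setIntegral_le_integral hsq (Eventually.of_forall fun t => by positivity)
      calc Φ r / (2 * r) ≤ (S + 2 * r * (1 + ‖f k‖)) / (2 * r) := by gcongr; linarith
        _ = 1 + ‖f k‖ + S / (2 * r) := by field_simp; ring
        _ ≤ _ := by gcongr
  have hC0 : 0 ≤ C := le_trans (by have := hΦ0 1; positivity) (hC 1 one_pos)
  have hAnn : ∀ r : ℝ, 0 < r → 0 ≤ Φ r / (2 * r) := fun r hr => by have := hΦ0 r; positivity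
  -- The coefficient 4·4⁻ⁿ/(πε) multiplied by the length 2·2ⁿε of the ball. Its summability allows
  -- dominated convergence in the series.
  set c : ℕ → ℝ := fun n => 8 / Real.pi * (2⁻¹ : ℝ) ^ n
  have hcs : Summable c := (summable_geometric_of_lt_one (by norm_num) (by norm_num)).mul_left _
  have hc0 : ∀ n, 0 ≤ c n := fun n => by positivity
  have hTan : Tendsto (fun ε : ℝ => ∑' n, c n * (Φ (2 ^ n * ε) / (2 * (2 ^ n * ε))))
      (𝓝[>] 0) (𝓝 0) := by
    have := tendsto_tsum_of_dominated_convergence (𝓕 := 𝓝[>] (0 : ℝ))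
      (f := fun ε n => c n * (Φ (2 ^ n * ε) / (2 * (2 ^ n * ε)))) (g := fun _ => (0 : ℝ))
      (bound := fun n => c n * C) (hcs.mul_right C) (fun n => ?_)
      (eventually_nhdsWithin_of_forall fun ε hε n => ?_)
    · simpa using this
    · have h1 : Tendsto (fun ε : ℝ => 2 ^ n * ε) (𝓝[>] 0) (𝓝[>] 0) := by
        refine tendsto_nhdsWithin_iff.2 ⟨?_, eventually_nhdsWithin_of_forall fun ε hε => ?_⟩
        · have : Tendsto (fun ε : ℝ => 2 ^ n * ε) (𝓝 0) (𝓝 (2 ^ n * 0)) :=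
            tendsto_id.const_mul _
          rw [mul_zero] at this
          exact this.mono_left nhdsWithin_le_nhds
        · have : (0 : ℝ) < ε := hε
          exact mul_pos (by positivity) this
      simpa using (hA.comp h1).const_mul (c n)
    · have hε' : 0 < (2 : ℝ) ^ n * ε := mul_pos (by positivity) hε
      rw [Real.norm_of_nonneg (mul_nonneg (hc0 n) (hAnn _ hε'))]
      exact mul_le_mul_of_nonneg_left (hC _ hε') (hc0 n)
  rw [tendsto_iff_norm_sub_tendsto_zero]
  refine squeeze_zero' (Eventually.of_forall fun _ => norm_nonneg _)
    (eventually_nhdsWithin_of_forall fun ε hε => ?_) hTan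
  have hε' : (0 : ℝ) < ε := hε
  have hzu : (k + ε * Complex.I : ℂ) ∈ uhp := by simpa [uhp] using hε'
  have hz0 : (k + ε * Complex.I : ℂ).im ≠ 0 := ne_of_gt hzu
  have hPf : Integrable fun t => (poisson (k + ε * Complex.I) t : ℂ) * f t :=
    (memLp_poisson hz0).integrable_mul hf
  have hPc := (integrable_poisson_ofReal hzu).mul_const (f k)
  have e1 : (∫ t, (poisson (k + ε * Complex.I) t : ℂ) * f t) - f k =
      ∫ t, (poisson (k + ε * Complex.I) t : ℂ) * (f t - f k) := by
    simp only [mul_sub]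
    rw [integral_sub hPf hPc, integral_mul_const, integral_poisson_ofReal hzu, one_mul]
  have hterm : ∀ n : ℕ, ENNReal.ofReal ((Real.pi * ε)⁻¹ * (4 * (4⁻¹ : ℝ) ^ n)) *
        (∫⁻ t in Metric.closedBall k (2 ^ n * ε), ‖f t - f k‖ₑ) =
      ENNReal.ofReal (c n * (Φ (2 ^ n * ε) / (2 * (2 ^ n * ε)))) := by
    intro n
    have h1 : (∫⁻ t in Metric.closedBall k (2 ^ n * ε), ‖f t - f k‖ₑ) =
        ENNReal.ofReal (Φ (2 ^ n * ε)) := by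
      rw [hΦ, ofReal_integral_eq_lintegral_ofReal (hI _)
        (Eventually.of_forall fun t => norm_nonneg _)]
      simp only [ofReal_norm]
    rw [h1, ← ENNReal.ofReal_mul (by positivity)]
    congr 1
    simp only [c]
    have h4 : (4⁻¹ : ℝ) ^ n = (2⁻¹ : ℝ) ^ n * (2⁻¹ : ℝ) ^ n := by rw [← mul_pow]; norm_num
    rw [h4, inv_pow]
    have := Real.pi_ne_zero
    field_simp
    ring
  have hsum : Summable fun n => c n * (Φ (2 ^ n * ε) / (2 * (2 ^ n * ε))) := by
    refine Summable.of_nonneg_of_le (fun n => mul_nonneg (hc0 n) (hAnn _ (by positivity)))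
      (fun n => ?_) (hcs.mul_right C)
    exact mul_le_mul_of_nonneg_left (hC _ (by positivity)) (hc0 n)
  have key : ‖(∫ t, (poisson (k + ε * Complex.I) t : ℂ) * f t) - f k‖ₑ ≤
      ENNReal.ofReal (∑' n, c n * (Φ (2 ^ n * ε) / (2 * (2 ^ n * ε)))) := by
    rw [e1, ENNReal.ofReal_tsum_of_nonneg
      (fun n => mul_nonneg (hc0 n) (hAnn _ (by positivity))) hsum]
    simp_rw [← hterm]
    refine (enorm_integral_le_lintegral_enorm _).trans ?_
    refine le_trans (lintegral_mono fun t => ?_)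
      (lintegral_poisson_le hε' (hf.1.sub aestronglyMeasurable_const).enorm)
    rw [enorm_mul]
    gcongr
    rw [← ofReal_norm, Complex.norm_real, Real.norm_of_nonneg (poisson_pos hzu t).le]
  rw [← ofReal_norm] at key
  refine (ENNReal.ofReal_le_ofReal_iff ?_).1 key
  exact tsum_nonneg fun n => mul_nonneg (hc0 n) (hAnn _ (by positivity))

/-! ### Boundary values and uniqueness for bounded holomorphic functions -/

theorem exists_weak_cluster_point {H : Type*} [NormedAddCommGroup H] [InnerProductSpace ℂ H]
    [CompleteSpace H] {ι : Type*} (l : Filter ι) [l.NeBot] (u : ι → H) {M : ℝ}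
    (hu : ∀ i, ‖u i‖ ≤ M) :
    ∃ (U : Ultrafilter ι) (g : H), (U : Filter ι) ≤ l ∧
      ∀ h : H, Tendsto (fun i => inner ℂ (u i) h) U (𝓝 (inner ℂ g h)) := by
  -- Banach–Alaoglu in the dual, transported back by the Riesz isomorphism; an ultrafilter takes the
  -- place of a subsequence.
  set f : ι → WeakDual ℂ H := fun i => StrongDual.toWeakDual (InnerProductSpace.toDual ℂ H (u i))
  have hc := WeakDual.isCompact_closedBall (𝕜 := ℂ) (E := H) 0 M
  obtain ⟨x, -, hx⟩ := hc.ultrafilter_le_nhds ((Ultrafilter.of l).map f) (by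
    refine le_principal_iff.2 (Ultrafilter.mem_map.2 (Filter.univ_mem' fun i => ?_))
    simpa [f] using hu i)
  refine ⟨Ultrafilter.of l, (InnerProductSpace.toDual ℂ H).symm (WeakDual.toStrongDual x),
    Ultrafilter.of_le l, fun h => ?_⟩
  have h1 : Tendsto (fun i => f i h) (Ultrafilter.of l) (𝓝 (x h)) :=
    ((WeakDual.eval_continuous h).tendsto x).comp hx
  simpa [f] using h1

/-- Bounded holomorphic functions on the upper half-plane. -/
def BddHol (G : ℂ → ℂ) : Prop :=
  DifferentiableOn ℂ G uhp ∧ ∃ M : ℝ, ∀ z ∈ uhp, ‖G z‖ ≤ M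

theorem add_mem_uhp {z : ℂ} (hz : 0 ≤ z.im) {ε : ℝ} (hε : 0 < ε) :
    z + ε * Complex.I ∈ uhp := by
  simp only [uhp, Set.mem_ofPred_eq, Complex.add_im, Complex.mul_im, Complex.ofReal_re,
    Complex.I_im, Complex.ofReal_im, Complex.I_re]
  linarith

theorem ofReal_add_mem_uhp (k : ℝ) {ε : ℝ} (hε : 0 < ε) : (k + ε * Complex.I : ℂ) ∈ uhp :=
  add_mem_uhp (by simp) hε

theorem one_le_norm_add_I {z : ℂ} (hz : 0 ≤ z.im) : 1 ≤ ‖z + Complex.I‖ := by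
  have := (le_abs_self _).trans (Complex.abs_im_le_norm (z + Complex.I))
  simp only [Complex.add_im, Complex.I_im] at this
  linarith

theorem add_I_ne_zero {z : ℂ} (hz : 0 ≤ z.im) : z + Complex.I ≠ 0 :=
  norm_pos_iff.1 (zero_lt_one.trans_le (one_le_norm_add_I hz))

theorem tendsto_vertical {F : ℂ → ℂ} (hF : DifferentiableOn ℂ F uhp) {z : ℂ} (hz : z ∈ uhp) :
    Tendsto (fun ε : ℝ => F (z + ε * Complex.I)) (𝓝[>] 0) (𝓝 (F z)) := by
  have h1 : ContinuousAt F z := (hF.differentiableAt (isOpen_uhp.mem_nhds hz)).continuousAt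
  have h2 : Tendsto (fun ε : ℝ => z + ε * Complex.I) (𝓝[>] 0) (𝓝 z) := by
    have : Continuous fun ε : ℝ => z + ε * Complex.I := by fun_prop
    have := this.tendsto 0
    simp only [Complex.ofReal_zero, zero_mul, add_zero] at this
    exact this.mono_left nhdsWithin_le_nhds
  exact h1.tendsto.comp h2

/-- Division by z + i bounds all horizontal slices by M/|x + i|, hence uniformly in L². The boundary
function is a weak limit of slices, and testing against the Poisson kernel passes the representation
on slightly higher lines to the limit. -/
theorem BddHol.exists_poisson_boundary {K : ℂ → ℂ} (hK : BddHol K) :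
    ∃ g : L2, ∀ z ∈ uhp, K z * (z + Complex.I)⁻¹ = ∫ t, (poisson z t : ℂ) * g t := by
  obtain ⟨hd, M, hM⟩ := hK
  have hM0 : 0 ≤ M := (norm_nonneg _).trans (hM Complex.I (by simp [uhp]))
  set K₁ : ℂ → ℂ := fun z => K z * (z + Complex.I)⁻¹ with hK₁
  have hd₁ : DifferentiableOn ℂ K₁ uhp :=
    hd.mul (DifferentiableOn.inv (by fun_prop) fun z hz => add_I_ne_zero (le_of_lt hz))
  have hM₁ : ∀ z ∈ uhp, ‖K₁ z‖ ≤ M := fun z hz => by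
    rw [hK₁, norm_mul, norm_inv]
    exact (mul_le_of_le_one_right (norm_nonneg _)
      (inv_le_one_of_one_le₀ (one_le_norm_add_I (le_of_lt hz)))).trans (hM z hz)
  have hmI : MemLp (fun x : ℝ => ((x : ℂ) - -Complex.I)⁻¹) 2 := memLp_inv_sub (by simp)
  set e : ℕ → ℝ := fun n => 1 / ((n : ℝ) + 1)
  have he : ∀ n, 0 < e n := fun n => Nat.one_div_pos_of_nat
  have hel : Tendsto e atTop (𝓝[>] 0) := tendsto_nhdsWithin_iff.2
    ⟨tendsto_one_div_add_atTop_nhds_zero_nat, Eventually.of_forall he⟩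
  have hpt : ∀ n (x : ℝ), ‖K₁ (x + e n * Complex.I)‖ ≤ M * ‖((x : ℂ) - -Complex.I)⁻¹‖ := by
    intro n x
    rw [hK₁, norm_mul, norm_inv, norm_inv, sub_neg_eq_add]
    have h1 : ‖(x : ℂ) + Complex.I‖ ≤ ‖(x + e n * Complex.I : ℂ) + Complex.I‖ := by
      rw [← sq_le_sq₀ (norm_nonneg _) (norm_nonneg _), ← Complex.normSq_eq_norm_sq,
        ← Complex.normSq_eq_norm_sq, Complex.normSq_apply, Complex.normSq_apply]
      simp only [Complex.add_re, Complex.ofReal_re, Complex.I_re, Complex.add_im,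
        Complex.ofReal_im, Complex.I_im, Complex.mul_re, Complex.mul_im]
      nlinarith [he n]
    have h2 : 0 < ‖(x : ℂ) + Complex.I‖ :=
      zero_lt_one.trans_le (one_le_norm_add_I (by simp))
    have h3 := hM _ (ofReal_add_mem_uhp x (he n))
    gcongr
  have hmem : ∀ n, MemLp (fun x : ℝ => K₁ (x + e n * Complex.I)) 2 := fun n =>
    hmI.of_le_mul (continuous_line hd₁ (he n)).aestronglyMeasurable (Eventually.of_forall (hpt n))
  obtain ⟨U, g, hU, hg⟩ := exists_weak_cluster_point (H := L2) atTop
    (fun n => (hmem n).toLp) (M := M * ‖hmI.toLp‖) (fun n => by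
      refine Lp.norm_le_mul_norm_of_ae_le_mul ?_
      filter_upwards [(hmem n).coeFn_toLp, hmI.coeFn_toLp] with x h1 h2
      rw [h1, h2]; exact hpt n x)
  refine ⟨g, fun z hz => ?_⟩
  have hz0 : z.im ≠ 0 := ne_of_gt hz
  set p : L2 := (memLp_poisson hz0).toLp with hp
  have hinner : ∀ v : L2, inner ℂ v p = starRingEnd ℂ (∫ t, (poisson z t : ℂ) * v t) := by
    intro v
    rw [L2.inner_def, ← integral_conj]
    refine integral_congr_ae ?_
    filter_upwards [(memLp_poisson hz0).coeFn_toLp] with x hx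
    rw [hp, hx]
    simp
  have h1 := hg p
  rw [hinner] at h1
  have h2 : ∀ n, inner ℂ ((hmem n).toLp : L2) p = starRingEnd ℂ (K₁ (z + e n * Complex.I)) := by
    intro n
    rw [hinner, ← integral_poisson_bounded hd₁ hM₁ (he n) hz]
    congr 1
    refine integral_congr_ae ?_
    filter_upwards [(hmem n).coeFn_toLp] with x hx
    rw [hx]
  simp_rw [h2] at h1
  have h3 : Tendsto (fun n => starRingEnd ℂ (K₁ (z + e n * Complex.I))) U
      (𝓝 (starRingEnd ℂ (K₁ z))) :=
    (Complex.continuous_conj.tendsto _).comp ((tendsto_vertical hd₁ hz).comp (hel.mono_left hU))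
  exact (starRingEnd ℂ).injective (tendsto_nhds_unique h3 h1)

/-- **Fatou's theorem** for bounded holomorphic functions. -/
theorem BddHol.exists_boundary {K : ℂ → ℂ} (hK : BddHol K) :
    ∃ g : ℝ → ℂ, Measurable g ∧
      ∀ᵐ k : ℝ, Tendsto (fun ε : ℝ => K (k + ε * Complex.I)) (𝓝[>] 0) (𝓝 (g k)) := by
  obtain ⟨g, hg⟩ := hK.exists_poisson_boundary
  refine ⟨fun k => (k + Complex.I) * g k,
    (by fun_prop : Measurable fun k : ℝ => (k : ℂ) + Complex.I).mul
      (Lp.stronglyMeasurable g).measurable, ?_⟩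
  filter_upwards [ae_tendsto_poisson_integral (Lp.memLp g)] with k hk
  have h1 : Tendsto (fun ε : ℝ => (k + ε * Complex.I : ℂ) + Complex.I) (𝓝[>] 0)
      (𝓝 ((k : ℂ) + Complex.I)) := by
    have : Continuous fun ε : ℝ => (k + ε * Complex.I : ℂ) + Complex.I := by fun_prop
    have := this.tendsto 0
    simp only [Complex.ofReal_zero, zero_mul, add_zero] at this
    exact this.mono_left nhdsWithin_le_nhds
  refine (h1.mul hk).congr' (eventually_nhdsWithin_of_forall fun ε hε => ?_)
  have hu := ofReal_add_mem_uhp k hε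
  rw [← hg _ hu]
  have := add_I_ne_zero (le_of_lt hu)
  field_simp

theorem ofReal_integral_poisson_mul (f : ℝ → ℝ) (z : ℂ) :
    ∫ t, (poisson z t : ℂ) * (f t : ℂ) = ((∫ t, poisson z t * f t : ℝ) : ℂ) := by
  rw [← integral_complex_ofReal]
  simp

theorem im_cauchyTransform_ofReal {f : ℝ → ℝ} (hf : Adm fun t => (f t : ℂ)) {z : ℂ}
    (hz : z.im ≠ 0) :
    (cauchyTransform (fun t => (f t : ℂ)) z).im = Real.pi * ∫ t, poisson z t * f t := by
  have h1 := integral_poisson_mul hf hz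
  have h2 := conj_cauchyTransform (fun t => (f t : ℂ)) z
  simp only [Complex.conj_ofReal] at h2
  rw [ofReal_integral_poisson_mul, ← h2] at h1
  set w := cauchyTransform (fun t => (f t : ℂ)) z
  have hpi : (Real.pi : ℂ) ≠ 0 := by exact_mod_cast Real.pi_ne_zero
  have h3 : w - starRingEnd ℂ w = 2 * w.im * Complex.I := by
    apply Complex.ext <;> simp; ring
  rw [h3] at h1
  have h4 : ((w.im : ℝ) : ℂ) = ((Real.pi * ∫ t, poisson z t * f t : ℝ) : ℂ) := by
    rw [Complex.ofReal_mul, h1]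
    field_simp
  exact_mod_cast h4

/-- Uniqueness theorem of F. and M. Riesz, for vertical limits of bounded holomorphic functions. -/
theorem BddHol.ae_ne_zero {K : ℂ → ℂ} (hK : BddHol K) {z : ℂ} (hz : z ∈ uhp) (hKz : K z ≠ 0)
    {g : ℝ → ℂ} (hg : Measurable g)
    (hlim : ∀ᵐ k : ℝ, Tendsto (fun ε : ℝ => K (k + ε * Complex.I)) (𝓝[>] 0) (𝓝 (g k))) :
    ∀ᵐ k : ℝ, g k ≠ 0 := by
  obtain ⟨hd, M, hM⟩ := hK
  have hM0 : 0 ≤ M := (norm_nonneg _).trans (hM z hz)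
  -- Cutting the zero set to bounded pieces makes the indicator function square integrable.
  suffices H : ∀ N : ℕ, ∀ᵐ k : ℝ, ¬ (k ∈ Set.Icc (-(N : ℝ)) N ∧ g k = 0) by
    filter_upwards [ae_all_iff.2 H] with k hk h0
    obtain ⟨N, hN⟩ := exists_nat_ge |k|
    exact hk N ⟨abs_le.1 hN, h0⟩
  intro N
  set E : Set ℝ := {k | k ∈ Set.Icc (-(N : ℝ)) N ∧ g k = 0} with hEdef
  have hE : MeasurableSet E :=
    measurableSet_Icc.inter (hg (measurableSet_singleton 0))
  have hEfin : volume E < ⊤ :=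
    (measure_mono fun k hk => hk.1 : volume E ≤ volume (Set.Icc (-(N : ℝ)) N)).trans_lt
      measure_Icc_lt_top
  suffices hE0 : volume E = 0 by
    rw [ae_iff]; simpa only [not_not] using hE0
  by_contra hE0
  set χ : ℝ → ℝ := E.indicator fun _ => 1 with hχ
  have hχ01 : ∀ t, 0 ≤ χ t ∧ χ t ≤ 1 := fun t => by
    by_cases h : t ∈ E <;> simp [hχ, h]
  have hχL : MemLp (fun t => (χ t : ℂ)) 2 :=
    MemLp.ofReal (memLp_indicator_const 2 hE 1 (Or.inr hEfin.ne))
  have hχA : Adm fun t => (χ t : ℂ) := adm_of_memLp hχL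
  set h : ℂ → ℝ := fun w => ∫ t, poisson w t * χ t with hh
  have hint : ∀ w ∈ uhp, Integrable fun t => poisson w t * χ t := fun w hw =>
    (integrable_poisson hw).mul_bdd (c := 1)
      (measurable_const.indicator hE).aestronglyMeasurable
      (Eventually.of_forall fun t => by
        rw [Real.norm_of_nonneg (hχ01 t).1]; exact (hχ01 t).2)
  have hh1 : ∀ w ∈ uhp, h w ≤ 1 := fun w hw => by
    rw [← integral_poisson hw]
    exact integral_mono (hint w hw) (integrable_poisson hw) fun t =>
      mul_le_of_le_one_right (poisson_pos hw t).le (hχ01 t).2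
  have hhpos : 0 < h z := by
    rw [hh, integral_pos_iff_support_of_nonneg
      (fun t => mul_nonneg (poisson_pos hz t).le (hχ01 t).1) (hint z hz)]
    refine lt_of_lt_of_le (pos_iff_ne_zero.2 hE0) (measure_mono fun t ht => ?_)
    simp [hχ, ht, (poisson_pos hz t).ne']
  -- The real part of `W` is the Poisson integral of the indicator of E, so exp(nW) has boundary
  -- modulus eⁿ a.e. on E and 1 a.e. off E.
  set W : ℂ → ℂ := fun w => (Real.pi * Complex.I)⁻¹ * cauchyTransform (fun t => (χ t : ℂ)) w with hW
  have hWre : ∀ w ∈ uhp, (W w).re = h w := by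
    intro w hw
    have h1 := im_cauchyTransform_ofReal hχA (ne_of_gt hw : w.im ≠ 0)
    have h2 : (W w).re = Real.pi⁻¹ * (cauchyTransform (fun t => (χ t : ℂ)) w).im := by
      simp [hW]
    rw [h2, h1, ← mul_assoc, inv_mul_cancel₀ Real.pi_ne_zero, one_mul]
  have hWd : DifferentiableOn ℂ W uhp := fun w hw =>
    ((differentiableAt_cauchyTransform hχA (ne_of_gt hw)).const_mul _).differentiableWithinAt
  -- The boundary modulus of K·exp(nW) is still at most M, because `K` has limit 0 where the
  -- exponential is large. The Poisson formula then bounds |K(z)|exp(n h(z)) by M for every n, which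
  -- is impossible when h(z) > 0 and K(z) ≠ 0.
  have hbd : ∀ n : ℕ, ‖K z‖ * Real.exp (n * h z) ≤ M := by
    intro n
    set Kn : ℂ → ℂ := fun w => K w * Complex.exp (n * W w) with hKn
    have hKnd : DifferentiableOn ℂ Kn uhp := hd.mul ((hWd.const_mul _).cexp)
    have hKnn : ∀ w ∈ uhp, ‖Kn w‖ = ‖K w‖ * Real.exp (n * h w) := by
      intro w hw
      rw [hKn, norm_mul, Complex.norm_exp]
      congr 2
      rw [← hWre w hw]; simp
    have hKnb : ∀ w ∈ uhp, ‖Kn w‖ ≤ M * Real.exp n := by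
      intro w hw
      rw [hKnn w hw]
      have := hM w hw
      have : (n : ℝ) * h w ≤ n := mul_le_of_le_one_right (Nat.cast_nonneg n) (hh1 w hw)
      gcongr
    rw [← hKnn z hz]
    have hL := (tendsto_vertical hKnd hz).norm
    set b : ℝ → ℝ := fun t => ‖g t‖ * Real.exp (n * χ t)
    have hR : Tendsto (fun ε : ℝ => ∫ t : ℝ, poisson z t * ‖Kn (t + ε * Complex.I)‖) (𝓝[>] 0)
        (𝓝 (∫ t : ℝ, poisson z t * b t)) := by
      refine tendsto_integral_filter_of_dominated_convergence
        (fun t => poisson z t * (M * Real.exp n))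
        (eventually_nhdsWithin_of_forall fun ε hε =>
          (measurable_poisson z).aestronglyMeasurable.mul
            (continuous_line hKnd hε).norm.aestronglyMeasurable)
        (eventually_nhdsWithin_of_forall fun ε hε => Eventually.of_forall fun t => ?_)
        ((integrable_poisson hz).mul_const _) ?_
      · rw [norm_mul, norm_norm, Real.norm_of_nonneg (poisson_pos hz t).le]
        exact mul_le_mul_of_nonneg_left (hKnb _ (ofReal_add_mem_uhp t hε)) (poisson_pos hz t).le
      · filter_upwards [hlim, ae_tendsto_poisson_integral hχL] with t ht1 ht2
        have ht3 : Tendsto (fun ε : ℝ => h (t + ε * Complex.I)) (𝓝[>] 0) (𝓝 (χ t)) := by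
          have := (Complex.continuous_re.tendsto _).comp ht2
          simp only [Function.comp_def, ofReal_integral_poisson_mul, Complex.ofReal_re] at this
          exact this
        have ht4 := (ht1.norm.mul ((Real.continuous_exp.tendsto _).comp
          (ht3.const_mul (n : ℝ)))).const_mul (poisson z t)
        refine ht4.congr' (eventually_nhdsWithin_of_forall fun ε hε => ?_)
        beta_reduce
        rw [hKnn _ (ofReal_add_mem_uhp t hε)]
        rfl
    have hle : ‖Kn z‖ ≤ ∫ t : ℝ, poisson z t * b t := by
      refine le_of_tendsto_of_tendsto hL hR (eventually_nhdsWithin_of_forall fun ε hε => ?_)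
      beta_reduce
      rw [← integral_poisson_bounded hKnd hKnb hε hz]
      refine (norm_integral_le_integral_norm _).trans (le_of_eq ?_)
      refine integral_congr_ae (Eventually.of_forall fun t => ?_)
      simp only [norm_mul, Complex.norm_real, Real.norm_of_nonneg (poisson_pos hz t).le]
    have hbM : ∀ᵐ t : ℝ, b t ≤ M := by
      filter_upwards [hlim] with t ht
      by_cases htE : t ∈ E
      · simp only [b, htE.2, norm_zero, zero_mul]; exact hM0
      · simp only [b, hχ, Set.indicator_of_notMem htE, mul_zero, Real.exp_zero, mul_one]
        exact le_of_tendsto ht.norm (eventually_nhdsWithin_of_forall fun ε hε =>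
          hM _ (ofReal_add_mem_uhp t hε))
    refine hle.trans ?_
    calc ∫ t : ℝ, poisson z t * b t ≤ ∫ t : ℝ, poisson z t * M := by
          refine integral_mono_of_nonneg (Eventually.of_forall fun t =>
            mul_nonneg (poisson_pos hz t).le (by positivity))
            ((integrable_poisson hz).mul_const _) ?_
          filter_upwards [hbM] with t ht
          exact mul_le_mul_of_nonneg_left ht (poisson_pos hz t).le
      _ = M := by rw [integral_mul_const, integral_poisson hz, one_mul]
  have hKpos : 0 < ‖K z‖ := norm_pos_iff.2 hKz
  obtain ⟨n, hn⟩ := exists_nat_gt (M / (‖K z‖ * h z))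
  have h1 := hbd n
  have h2 : (n : ℝ) * h z ≤ Real.exp (n * h z) := by
    have := Real.add_one_le_exp (n * h z); linarith
  rw [div_lt_iff₀ (by positivity)] at hn
  have : ‖K z‖ * (n * h z) ≤ ‖K z‖ * Real.exp (n * h z) := by gcongr
  linarith

theorem BddHol.add {F G : ℂ → ℂ} (hF : BddHol F) (hG : BddHol G) :
    BddHol (fun z => F z + G z) := by
  obtain ⟨hF, M, hM⟩ := hF
  obtain ⟨hG, N, hN⟩ := hG
  exact ⟨hF.add hG, M + N, fun z hz => (norm_add_le _ _).trans (add_le_add (hM z hz) (hN z hz))⟩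

theorem BddHol.mul {F G : ℂ → ℂ} (hF : BddHol F) (hG : BddHol G) :
    BddHol (fun z => F z * G z) := by
  obtain ⟨hF, M, hM⟩ := hF
  obtain ⟨hG, N, hN⟩ := hG
  refine ⟨hF.mul hG, M * N, fun z hz => ?_⟩
  rw [norm_mul]
  exact mul_le_mul (hM z hz) (hN z hz) (norm_nonneg _) ((norm_nonneg _).trans (hM z hz))

theorem bddHol_const (c : ℂ) : BddHol (fun _ => c) :=
  ⟨differentiableOn_const c, ‖c‖, fun _ _ => le_rfl⟩

/-! ### Cauchy transforms as quotients of bounded functions -/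

/-- Quotients of bounded holomorphic functions on the upper half-plane with zero-free
denominator. -/
def Nev (F : ℂ → ℂ) : Prop :=
  ∃ G H : ℂ → ℂ, BddHol G ∧ BddHol H ∧ (∀ z ∈ uhp, H z ≠ 0) ∧ ∀ z ∈ uhp, F z = G z / H z

theorem Nev.add {F₁ F₂ : ℂ → ℂ} (h₁ : Nev F₁) (h₂ : Nev F₂) : Nev (fun z => F₁ z + F₂ z) := by
  obtain ⟨G₁, H₁, hG₁, hH₁, hn₁, he₁⟩ := h₁
  obtain ⟨G₂, H₂, hG₂, hH₂, hn₂, he₂⟩ := h₂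
  refine ⟨_, _, (hG₁.mul hH₂).add (hH₁.mul hG₂), hH₁.mul hH₂,
    fun z hz => mul_ne_zero (hn₁ z hz) (hn₂ z hz), fun z hz => ?_⟩
  simp only [he₁ z hz, he₂ z hz]
  exact div_add_div _ _ (hn₁ z hz) (hn₂ z hz)

theorem Nev.mul {F₁ F₂ : ℂ → ℂ} (h₁ : Nev F₁) (h₂ : Nev F₂) : Nev (fun z => F₁ z * F₂ z) := by
  obtain ⟨G₁, H₁, hG₁, hH₁, hn₁, he₁⟩ := h₁
  obtain ⟨G₂, H₂, hG₂, hH₂, hn₂, he₂⟩ := h₂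
  refine ⟨_, _, hG₁.mul hG₂, hH₁.mul hH₂,
    fun z hz => mul_ne_zero (hn₁ z hz) (hn₂ z hz), fun z hz => ?_⟩
  simp only [he₁ z hz, he₂ z hz]
  exact div_mul_div_comm _ _ _ _

theorem nev_const (c : ℂ) : Nev (fun _ => c) :=
  ⟨fun _ => c, fun _ => 1, bddHol_const c, bddHol_const 1, fun _ _ => one_ne_zero, fun _ _ => by simp⟩

theorem Nev.congr {F₁ F₂ : ℂ → ℂ} (h₁ : Nev F₁) (h : ∀ z ∈ uhp, F₂ z = F₁ z) : Nev F₂ := by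
  obtain ⟨G₁, H₁, hG₁, hH₁, hn₁, he₁⟩ := h₁
  exact ⟨G₁, H₁, hG₁, hH₁, hn₁, fun z hz => (h z hz).trans (he₁ z hz)⟩

/-- The transform F has nonnegative imaginary part in the upper half-plane, so H = 1/(F + i) is
bounded by 1, and F = (1 - iH)/H. -/
theorem nev_cauchyTransform_of_nonneg {f : ℝ → ℝ} (hf : Adm fun t => (f t : ℂ))
    (h0 : ∀ t, 0 ≤ f t) : Nev (cauchyTransform fun t => (f t : ℂ)) := by
  set F := cauchyTransform fun t => (f t : ℂ)
  have him : ∀ z ∈ uhp, 0 ≤ (F z).im := fun z hz => by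
    rw [im_cauchyTransform_ofReal hf (ne_of_gt hz)]
    exact mul_nonneg Real.pi_pos.le
      (integral_nonneg fun t => mul_nonneg (poisson_pos hz t).le (h0 t))
  have hd : DifferentiableOn ℂ F uhp := fun z hz =>
    (differentiableAt_cauchyTransform hf (ne_of_gt hz)).differentiableWithinAt
  have hH : BddHol fun z => (F z + Complex.I)⁻¹ := by
    refine ⟨(hd.add_const _).inv fun z hz => add_I_ne_zero (him z hz), 1, fun z hz => ?_⟩
    rw [norm_inv]
    exact inv_le_one_of_one_le₀ (one_le_norm_add_I (him z hz))
  refine ⟨_, _, (bddHol_const 1).add ((bddHol_const (-Complex.I)).mul hH), hH,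
    fun z hz => inv_ne_zero (add_I_ne_zero (him z hz)), fun z hz => ?_⟩
  have := add_I_ne_zero (him z hz)
  field_simp
  ring

/-- The density is split into the positive and negative parts of its real and imaginary parts. -/
theorem nev_cauchyTransform {f : ℝ → ℂ} (hf : Adm f) : Nev (cauchyTransform f) := by
  have hm := aestronglyMeasurable_of_adm hf
  have hre : AEStronglyMeasurable (fun t => (f t).re) := Complex.continuous_re.comp_aestronglyMeasurable hm
  have him : AEStronglyMeasurable (fun t => (f t).im) := Complex.continuous_im.comp_aestronglyMeasurable hm
  have key : ∀ u : ℝ → ℝ, AEStronglyMeasurable u → (∀ t, |u t| ≤ ‖f t‖) →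
      (Adm fun t => ((max (u t) 0 : ℝ) : ℂ)) := by
    intro u hu hle
    refine hf.mono (Complex.continuous_ofReal.comp_aestronglyMeasurable
      (hu.sup aestronglyMeasurable_const)) fun t => ?_
    rw [Complex.norm_real, Real.norm_of_nonneg (le_max_right _ _)]
    exact (max_le (le_abs_self _) (abs_nonneg _)).trans (hle t)
  have a1 := key _ hre fun t => Complex.abs_re_le_norm _
  have a2 := key _ hre.neg fun t => by simpa using Complex.abs_re_le_norm (f t)
  have a3 := key _ him fun t => Complex.abs_im_le_norm _
  have a4 := key _ him.neg fun t => by simpa using Complex.abs_im_le_norm (f t)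
  have n1 := nev_cauchyTransform_of_nonneg a1 fun t => le_max_right _ _
  have n2 := nev_cauchyTransform_of_nonneg a2 fun t => le_max_right _ _
  have n3 := nev_cauchyTransform_of_nonneg a3 fun t => le_max_right _ _
  have n4 := nev_cauchyTransform_of_nonneg a4 fun t => le_max_right _ _
  refine ((n1.add ((nev_const (-1)).mul n2)).add ((nev_const Complex.I).mul
    (n3.add ((nev_const (-1)).mul n4)))).congr fun z hz => ?_
  have hz0 : z.im ≠ 0 := ne_of_gt hz
  rw [← cauchyTransform_const_mul, ← cauchyTransform_const_mul, ← cauchyTransform_add a1 (a2.const_mul _) hz0,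
    ← cauchyTransform_add a3 (a4.const_mul _) hz0, ← cauchyTransform_const_mul,
    ← cauchyTransform_add (a1.add (a2.const_mul _)) ((a3.add (a4.const_mul _)).const_mul _) hz0]
  congr 1
  ext t
  have hmax : ∀ r : ℝ, max r 0 - max (-r) 0 = r := fun r => by
    rcases le_total 0 r with h | h
    · rw [max_eq_left h, max_eq_right (by linarith)]; ring
    · rw [max_eq_right h, max_eq_left (by linarith)]; ring
  have e1 := congrArg (fun r : ℝ => (r : ℂ)) (hmax (f t).re)
  have e2 := congrArg (fun r : ℝ => (r : ℂ)) (hmax (f t).im)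
  simp only [Complex.ofReal_sub] at e1 e2
  simp only [Pi.neg_apply]
  conv_lhs => rw [← Complex.re_add_im (f t), ← e1, ← e2]
  ring

/-- Uniqueness is used twice: for the denominator, so that the limit exists, and for the numerator,
so that it is nonzero. -/
theorem Nev.ae_tendsto_ne_zero {F : ℂ → ℂ} (hF : Nev F) {z : ℂ} (hz : z ∈ uhp) (hFz : F z ≠ 0) :
    ∀ᵐ k : ℝ, ∃ l : ℂ, l ≠ 0 ∧
      Tendsto (fun ε : ℝ => F (k + ε * Complex.I)) (𝓝[>] 0) (𝓝 l) := by
  obtain ⟨G, H, hG, hH, hn, he⟩ := hF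
  obtain ⟨g, hg, hgl⟩ := hG.exists_boundary
  obtain ⟨h, hh, hhl⟩ := hH.exists_boundary
  have hGz : G z ≠ 0 := fun h0 => hFz (by rw [he z hz, h0, zero_div])
  filter_upwards [hgl, hhl, hG.ae_ne_zero hz hGz hg hgl, hH.ae_ne_zero hz (hn z hz) hh hhl]
    with k h1 h2 h3 h4
  refine ⟨g k / h k, div_ne_zero h3 h4, (h1.div h2 h4).congr'
    (eventually_nhdsWithin_of_forall fun ε hε => (he _ (ofReal_add_mem_uhp k hε)).symm)⟩

theorem Nev.ae_tendsto {F : ℂ → ℂ} (hF : Nev F) :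
    ∀ᵐ k : ℝ, ∃ l : ℂ, Tendsto (fun ε : ℝ => F (k + ε * Complex.I)) (𝓝[>] 0) (𝓝 l) := by
  obtain ⟨G, H, hG, hH, hn, he⟩ := hF
  obtain ⟨g, hg, hgl⟩ := hG.exists_boundary
  obtain ⟨h, hh, hhl⟩ := hH.exists_boundary
  have hI : Complex.I ∈ uhp := by simp [uhp]
  filter_upwards [hgl, hhl, hH.ae_ne_zero hI (hn _ hI) hh hhl] with k h1 h2 h4
  exact ⟨g k / h k, (h1.div h2 h4).congr'
    (eventually_nhdsWithin_of_forall fun ε hε => (he _ (ofReal_add_mem_uhp k hε)).symm)⟩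

theorem Nev.eq_zero_of_ae_tendsto_zero {F : ℂ → ℂ} (hF : Nev F)
    (h0 : ∀ᵐ k : ℝ, Tendsto (fun ε : ℝ => F (k + ε * Complex.I)) (𝓝[>] 0) (𝓝 0)) {z : ℂ}
    (hz : z ∈ uhp) : F z = 0 := by
  by_contra h
  obtain ⟨k, h1, l, hl, h2⟩ := (h0.and (hF.ae_tendsto_ne_zero hz h)).exists
  exact hl (tendsto_nhds_unique h2 h1)

/-! ### L² convergence of Poisson integrals and the converse description of H₂⁺ -/

theorem eLpNorm_two_sq {α : Type*} [MeasurableSpace α] (μ : Measure α) (f : α → ℂ) :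
    eLpNorm f 2 μ ^ 2 = ∫⁻ x, ‖f x‖ₑ ^ 2 ∂μ := by
  have := eLpNorm_nnreal_pow_eq_lintegral (μ := μ) (f := f) (p := 2) two_ne_zero
  simpa using this

theorem enorm_integral_sq_le {ν : Measure ℝ} [IsProbabilityMeasure ν] {u : ℝ → ℂ}
    (hu : AEStronglyMeasurable u ν) : ‖∫ s, u s ∂ν‖ₑ ^ 2 ≤ ∫⁻ s, ‖u s‖ₑ ^ 2 ∂ν := by
  rw [← eLpNorm_two_sq]
  gcongr
  refine (enorm_integral_le_lintegral_enorm _).trans ?_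
  rw [← eLpNorm_one_eq_lintegral_enorm]
  exact eLpNorm_le_eLpNorm_of_exponent_le (by norm_num) hu

theorem measurePreserving_add_right' (h : ℝ) : MeasurePreserving (fun x : ℝ => x + h) :=
  measurePreserving_add_right volume h

/-- Continuity of translations in `L²`. -/
theorem tendsto_eLpNorm_translate (g : L2) :
    Tendsto (fun h : ℝ => eLpNorm (fun x : ℝ => g (x + h) - g x) 2) (𝓝 0) (𝓝 0) := by
  set τ : ℝ → C(ℝ, ℝ) := fun h => ⟨fun x => x + h, by fun_prop⟩ with hτ
  have hτc : Continuous τ := by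
    have : Continuous (Function.uncurry fun (h x : ℝ) => x + h) := by
      simp only [Function.uncurry_def]; fun_prop
    exact (ContinuousMap.curry ⟨_, this⟩).continuous
  have hmp : ∀ h, MeasurePreserving (τ h) volume volume := measurePreserving_add_right'
  have h1 : Tendsto (fun h => Lp.compMeasurePreserving (τ h) (hmp h) g) (𝓝 0)
      (𝓝 (Lp.compMeasurePreserving (τ 0) (hmp 0) g)) :=
    Filter.Tendsto.compMeasurePreservingLp tendsto_const_nhds (hτc.tendsto 0) hmp (hmp 0)
      (by norm_num)
  have h0 : Lp.compMeasurePreserving (τ 0) (hmp 0) g = g := by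
    refine Lp.ext ?_
    filter_upwards [Lp.coeFn_compMeasurePreserving g (hmp 0)] with x hx
    rw [hx]; simp [hτ]
  rw [h0] at h1
  have h2 := (tendsto_iff_edist_tendsto_0.1 h1)
  refine h2.congr fun h => ?_
  rw [Lp.edist_def]
  refine eLpNorm_congr_ae ?_
  filter_upwards [Lp.coeFn_compMeasurePreserving g (hmp h)] with x hx
  simp only [Pi.sub_apply, hx]
  rfl

theorem eLpNorm_translate_le (g : L2) (h : ℝ) :
    eLpNorm (fun x : ℝ => g (x + h) - g x) 2 ≤ 2 * eLpNorm g 2 := by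
  have h1 : eLpNorm (fun x : ℝ => g (x + h)) 2 = eLpNorm g 2 :=
    eLpNorm_comp_measurePreserving (Lp.memLp g).1 (measurePreserving_add_right' h)
  have h2 : AEStronglyMeasurable (fun x : ℝ => g (x + h)) :=
    (Lp.memLp g).1.comp_measurePreserving (measurePreserving_add_right' h)
  refine (eLpNorm_sub_le h2 (Lp.memLp g).1 (by norm_num)).trans ?_
  rw [h1, two_mul]

/-- The standard Cauchy distribution, that is the Poisson kernel at height one. -/
def cauchyLaw : Measure ℝ :=
  volume.withDensity fun s => ((Real.toNNReal (Real.pi⁻¹ * (1 + s ^ 2)⁻¹) : NNReal) : ENNReal)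

theorem measurable_cauchyLaw_density :
    Measurable fun s : ℝ => Real.toNNReal (Real.pi⁻¹ * (1 + s ^ 2)⁻¹) := by fun_prop

theorem integrable_cauchy_density : Integrable fun s : ℝ => Real.pi⁻¹ * (1 + s ^ 2)⁻¹ :=
  integrable_inv_one_add_sq.const_mul _

instance : IsProbabilityMeasure cauchyLaw := ⟨by
  rw [cauchyLaw, withDensity_apply _ MeasurableSet.univ, Measure.restrict_univ]
  have := ofReal_integral_eq_lintegral_ofReal integrable_cauchy_density
    (Eventually.of_forall fun s => by positivity)
  rw [integral_cauchy_density, ENNReal.ofReal_one] at this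
  exact this.symm⟩

theorem integral_cauchyLaw (u : ℝ → ℂ) :
    ∫ s, u s ∂cauchyLaw = ∫ s : ℝ, (Real.pi⁻¹ * (1 + s ^ 2)⁻¹) • u s := by
  rw [cauchyLaw, integral_withDensity_eq_integral_smul measurable_cauchyLaw_density]
  refine integral_congr_ae (Eventually.of_forall fun s => ?_)
  simp only [NNReal.smul_def]
  rw [Real.coe_toNNReal _ (by positivity)]

theorem integrable_cauchyLaw {u : ℝ → ℂ} :
    Integrable u cauchyLaw ↔ Integrable fun s : ℝ => (Real.pi⁻¹ * (1 + s ^ 2)⁻¹) • u s := by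
  rw [cauchyLaw, integrable_withDensity_iff_integrable_smul measurable_cauchyLaw_density]
  refine integrable_congr (Eventually.of_forall fun s => ?_)
  simp only [NNReal.smul_def]
  rw [Real.coe_toNNReal _ (by positivity)]

theorem integrable_cauchyLaw_comp (g : L2) (x : ℝ) {y : ℝ} (hy : 0 < y) :
    Integrable (fun s => g (x + y * s)) cauchyLaw := by
  rw [integrable_cauchyLaw]
  have hz : (x + y * Complex.I : ℂ).im ≠ 0 := ne_of_gt (ofReal_add_mem_uhp x hy)
  have h1 : Integrable fun t => (poisson (x + y * Complex.I) t : ℂ) * g t :=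
    (memLp_poisson hz).integrable_mul (Lp.memLp g)
  have h2 := ((h1.comp_add_left x).comp_mul_left' hy.ne').const_mul (y : ℂ)
  refine h2.congr (Eventually.of_forall fun s => ?_)
  have : (y : ℂ) ≠ 0 := by exact_mod_cast hy.ne'
  simp only [poisson_affine hy, Complex.real_smul]
  push_cast
  field_simp

/-- The Poisson integral at height y is the mean of g(x + ys) for s under the Cauchy law; Jensen's
inequality and Tonelli give the bound. -/
theorem eLpNorm_poisson_sub_sq_le (g : L2) {y : ℝ} (hy : 0 < y) :
    eLpNorm (fun x : ℝ => (∫ t, (poisson (x + y * Complex.I) t : ℂ) * g t) - g x) 2 ^ 2 ≤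
      ∫⁻ s, eLpNorm (fun x : ℝ => g (x + y * s) - g x) 2 ^ 2 ∂cauchyLaw := by
  have hgm : Measurable g := (Lp.stronglyMeasurable g).measurable
  rw [eLpNorm_two_sq]
  calc ∫⁻ x : ℝ, ‖(∫ t, (poisson (x + y * Complex.I) t : ℂ) * g t) - g x‖ₑ ^ 2
      ≤ ∫⁻ x : ℝ, ∫⁻ s, ‖g (x + y * s) - g x‖ₑ ^ 2 ∂cauchyLaw := by
        refine lintegral_mono fun x => ?_
        have h1 : (∫ t, (poisson (x + y * Complex.I) t : ℂ) * g t) - g x =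
            ∫ s, (g (x + y * s) - g x) ∂cauchyLaw := by
          rw [integral_sub (integrable_cauchyLaw_comp g x hy) (integrable_const _)]
          simp only [integral_const, probReal_univ, one_smul]
          rw [integral_cauchyLaw, ← integral_poisson_smul hy]
          simp only [Complex.real_smul]
        rw [h1]
        refine enorm_integral_sq_le (Measurable.aestronglyMeasurable ?_)
        fun_prop
    _ = ∫⁻ s, (∫⁻ x : ℝ, ‖g (x + y * s) - g x‖ₑ ^ 2) ∂cauchyLaw := by
        refine lintegral_lintegral_swap (Measurable.aemeasurable ?_)
        simp only [Function.uncurry_def]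
        fun_prop
    _ = _ := by simp only [eLpNorm_two_sq]

theorem tendsto_eLpNorm_poisson_sub (g : L2) :
    Tendsto (fun y : ℝ => eLpNorm (fun x : ℝ =>
      (∫ t, (poisson (x + y * Complex.I) t : ℂ) * g t) - g x) 2) (𝓝[>] 0) (𝓝 0) := by
  have hgm : Measurable g := (Lp.stronglyMeasurable g).measurable
  have h1 : Tendsto (fun y : ℝ =>
      ∫⁻ s, eLpNorm (fun x : ℝ => g (x + y * s) - g x) 2 ^ 2 ∂cauchyLaw) (𝓝[>] 0)
      (𝓝 (∫⁻ _ : ℝ, 0 ∂cauchyLaw)) := by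
    refine tendsto_lintegral_filter_of_dominated_convergence
      (fun _ => (2 * eLpNorm g 2) ^ 2) (Eventually.of_forall fun y => ?_)
      (Eventually.of_forall fun y => Eventually.of_forall fun s => ?_) ?_
      (Eventually.of_forall fun s => ?_)
    · simp only [eLpNorm_two_sq]
      refine Measurable.lintegral_prod_right' (f := fun p : ℝ × ℝ =>
        ‖g (p.2 + y * p.1) - g p.2‖ₑ ^ 2) ?_
      fun_prop
    · gcongr
      exact eLpNorm_translate_le g _
    · rw [lintegral_const, measure_univ, mul_one]
      exact ENNReal.pow_ne_top (ENNReal.mul_ne_top (by simp) (Lp.memLp g).eLpNorm_ne_top)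
    · have h2 : Tendsto (fun y : ℝ => y * s) (𝓝[>] 0) (𝓝 0) := by
        have : Continuous fun y : ℝ => y * s := by fun_prop
        have := this.tendsto 0
        rw [zero_mul] at this
        exact this.mono_left nhdsWithin_le_nhds
      have h3 := ((tendsto_eLpNorm_translate g).comp h2)
      have h4 := ((ENNReal.continuous_pow 2).tendsto 0).comp h3
      rw [zero_pow two_ne_zero] at h4
      exact h4
  rw [lintegral_zero] at h1
  have h2 : Tendsto (fun y : ℝ => eLpNorm (fun x : ℝ =>
      (∫ t, (poisson (x + y * Complex.I) t : ℂ) * g t) - g x) 2 ^ 2) (𝓝[>] 0) (𝓝 0) :=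
    tendsto_of_tendsto_of_tendsto_of_le_of_le' tendsto_const_nhds h1
      (Eventually.of_forall fun _ => zero_le)
      (eventually_nhdsWithin_of_forall fun y hy => eLpNorm_poisson_sub_sq_le g hy)
  have h3 := ((ENNReal.continuous_rpow_const (y := (2 : ℝ)⁻¹)).tendsto 0).comp h2
  rw [ENNReal.zero_rpow_of_pos (by norm_num)] at h3
  refine h3.congr fun y => ?_
  simp only [Function.comp_def]
  rw [← ENNReal.rpow_natCast, ← ENNReal.rpow_mul]
  norm_num

theorem eLpNorm_poisson_le (g : L2) {y : ℝ} (hy : 0 < y) :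
    eLpNorm (fun x : ℝ => (∫ t, (poisson (x + y * Complex.I) t : ℂ) * g t) - g x) 2 ≤
      2 * eLpNorm g 2 := by
  have h1 := eLpNorm_poisson_sub_sq_le g hy
  have h2 : ∫⁻ s, eLpNorm (fun x : ℝ => g (x + y * s) - g x) 2 ^ 2 ∂cauchyLaw ≤
      (2 * eLpNorm g 2) ^ 2 := by
    calc _ ≤ ∫⁻ _, (2 * eLpNorm g 2) ^ 2 ∂cauchyLaw := by
          refine lintegral_mono fun s => ?_
          gcongr
          exact eLpNorm_translate_le g _
      _ = _ := by rw [lintegral_const, measure_univ, mul_one]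
  exact (ENNReal.pow_le_pow_left_iff two_ne_zero).1 (h1.trans h2)

/-- A function whose Cauchy transform vanishes in the lower half-plane belongs to `H₂⁺`. -/
theorem mem_hardyPlus_of_cauchyTransform_eq_zero {g : L2}
    (hg : ∀ ζ : ℂ, ζ.im < 0 → cauchyTransform g ζ = 0) : g ∈ hardyPlus := by
  set F : ℂ → ℂ := fun z => (2 * Real.pi * Complex.I)⁻¹ * cauchyTransform g z with hF
  have hFd : DifferentiableOn ℂ F uhp := fun z hz =>
    ((differentiableAt_cauchyTransform (adm_L2 g) (ne_of_gt hz)).const_mul _).differentiableWithinAt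
  -- The transform at the conjugate point vanishes by hypothesis, so only the upper term of the
  -- Poisson formula survives.
  have hFP : ∀ z ∈ uhp, F z = ∫ t, (poisson z t : ℂ) * g t := fun z hz => by
    rw [integral_poisson_mul (adm_L2 g) (ne_of_gt hz), hg (starRingEnd ℂ z)
      (by simpa [uhp] using hz), sub_zero]
  have hFy : ∀ y : ℝ, 0 < y → (fun x : ℝ => F (x + y * Complex.I) - g x) =
      fun x : ℝ => (∫ t, (poisson (x + y * Complex.I) t : ℂ) * g t) - g x := fun y hy => by
    ext x; rw [hFP _ (ofReal_add_mem_uhp x hy)]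
  have hgtop := (Lp.memLp g).eLpNorm_ne_top
  refine ⟨F, hFd, ⟨(3 * eLpNorm g 2).toNNReal, fun y hy => ?_⟩, ?_⟩
  · rw [ENNReal.coe_toNNReal (ENNReal.mul_ne_top (by simp) hgtop)]
    have h1 : (fun x : ℝ => F (x + y * Complex.I)) =
        (fun x : ℝ => F (x + y * Complex.I) - g x) + g := by ext x; simp
    rw [h1]
    refine (eLpNorm_add_le ((continuous_line hFd hy).aestronglyMeasurable.sub (Lp.memLp g).1)
      (Lp.memLp g).1 (by norm_num)).trans ?_
    change eLpNorm (fun x : ℝ => F (x + y * Complex.I) - g x) 2 volume + _ ≤ _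
    rw [hFy y hy]
    refine (add_le_add_left (eLpNorm_poisson_le g hy) _).trans (le_of_eq ?_)
    ring
  · refine (tendsto_eLpNorm_poisson_sub g).congr' (eventually_nhdsWithin_of_forall fun y hy => ?_)
    beta_reduce
    rw [hFy y hy]

/-- Boundary values of the Cauchy transform of a function in `H₂⁺`. -/
theorem ae_tendsto_cauchyTransform_hardyPlus {g : L2} (hg : g ∈ hardyPlus) :
    ∀ᵐ k : ℝ, Tendsto (fun ε : ℝ => cauchyTransform g (k + ε * Complex.I)) (𝓝[>] 0)
      (𝓝 (2 * Real.pi * Complex.I * g k)) := by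
  filter_upwards [ae_tendsto_poisson_integral (Lp.memLp g)] with k hk
  refine (hk.const_mul (2 * Real.pi * Complex.I)).congr'
    (eventually_nhdsWithin_of_forall fun ε hε => ?_)
  have hu := ofReal_add_mem_uhp k hε
  rw [integral_poisson_mul (adm_L2 g) (ne_of_gt hu), cauchyTransform_eq_zero_of_hardyPlus hg
      (ζ := starRingEnd ℂ _) (by simpa [uhp] using hu), sub_zero, ← mul_assoc,
      mul_inv_cancel₀ Complex.two_pi_I_ne_zero, one_mul]

/-! ### Multiplication by 1/(x - z) on L² -/

theorem norm_inv_sub_le {z : ℂ} (hz : z.im ≠ 0) (x : ℝ) : ‖((x : ℂ) - z)⁻¹‖ ≤ |z.im|⁻¹ := by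
  have := abs_pos.2 hz
  rw [norm_inv]
  gcongr
  simpa using Complex.abs_im_le_norm ((x : ℂ) - z)

theorem memLp_mul_inv_sub (f : L2) {z : ℂ} (hz : z.im ≠ 0) :
    MemLp (fun x : ℝ => f x * ((x : ℂ) - z)⁻¹) 2 :=
  (Lp.memLp f).of_le_mul (c := |z.im|⁻¹)
    ((Lp.memLp f).1.mul (measurable_inv_sub z).aestronglyMeasurable)
    (Eventually.of_forall fun x => by
      rw [norm_mul, mul_comm]
      exact mul_le_mul_of_nonneg_right (norm_inv_sub_le hz x) (norm_nonneg _))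

/-- The function `1 / (x - z)` in `L²`. -/
def invSub (z : ℂ) (hz : z.im ≠ 0) : L2 := (memLp_inv_sub hz).toLp

theorem coeFn_invSub (z : ℂ) (hz : z.im ≠ 0) :
    invSub z hz =ᵐ[volume] fun x : ℝ => ((x : ℂ) - z)⁻¹ := (memLp_inv_sub hz).coeFn_toLp

/-- Multiplication by `1 / (x - z)` on `L²`. -/
def mulInv (z : ℂ) (hz : z.im ≠ 0) : L2 →L[ℂ] L2 :=
  LinearMap.mkContinuous
    { toFun := fun f => (memLp_mul_inv_sub f hz).toLp
      map_add' := fun f g => by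
        refine Lp.ext ?_
        filter_upwards [(memLp_mul_inv_sub (f + g) hz).coeFn_toLp,
          (memLp_mul_inv_sub f hz).coeFn_toLp, (memLp_mul_inv_sub g hz).coeFn_toLp,
          Lp.coeFn_add f g, Lp.coeFn_add ((memLp_mul_inv_sub f hz).toLp)
            ((memLp_mul_inv_sub g hz).toLp)] with x h1 h2 h3 h4 h5
        rw [h1, h5, Pi.add_apply, h2, h3, h4, Pi.add_apply, add_mul]
      map_smul' := fun c f => by
        refine Lp.ext ?_
        filter_upwards [(memLp_mul_inv_sub (c • f) hz).coeFn_toLp,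
          (memLp_mul_inv_sub f hz).coeFn_toLp, Lp.coeFn_smul c f,
          Lp.coeFn_smul c ((memLp_mul_inv_sub f hz).toLp)] with x h1 h2 h3 h4
        rw [h1, RingHom.id_apply, h4, Pi.smul_apply, h2, h3, Pi.smul_apply, smul_eq_mul,
          smul_eq_mul, mul_assoc] }
    |z.im|⁻¹ fun f => by
      refine Lp.norm_le_mul_norm_of_ae_le_mul ?_
      filter_upwards [(memLp_mul_inv_sub f hz).coeFn_toLp] with x h1
      simp only [LinearMap.coe_mk, AddHom.coe_mk]
      rw [h1, norm_mul, mul_comm]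
      exact mul_le_mul_of_nonneg_right (norm_inv_sub_le hz x) (norm_nonneg _)

theorem coeFn_mulInv (z : ℂ) (hz : z.im ≠ 0) (f : L2) :
    mulInv z hz f =ᵐ[volume] fun x : ℝ => f x * ((x : ℂ) - z)⁻¹ :=
  (memLp_mul_inv_sub f hz).coeFn_toLp

theorem inner_mulInv (g f : L2) {z : ℂ} (hz : z.im ≠ 0) :
    inner ℂ g (mulInv z hz f) = cauchyTransform (fun x => f x * starRingEnd ℂ (g x)) z := by
  rw [L2.inner_def, cauchyTransform]
  refine integral_congr_ae ?_
  filter_upwards [coeFn_mulInv z hz f] with x hx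
  rw [hx]
  simp only [RCLike.inner_apply]
  ring

theorem inner_invSub (g : L2) {z : ℂ} (hz : z.im ≠ 0) :
    inner ℂ g (invSub z hz) = cauchyTransform (fun x => starRingEnd ℂ (g x)) z := by
  rw [L2.inner_def, cauchyTransform]
  refine integral_congr_ae ?_
  filter_upwards [coeFn_invSub z hz] with x hx
  rw [hx]
  simp only [RCLike.inner_apply]
  ring

theorem inner_mulInv_self_sub (φ ψ : L2) {z : ℂ} (hz : z.im ≠ 0) :
    inner ℂ φ (mulInv z hz ψ) = D φ ψ z - 1 := by
  rw [inner_mulInv, D]; ring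

/-- The Cauchy transform at a fixed point as a functional on `L²`. -/
def cauchyL (z : ℂ) (hz : z.im ≠ 0) : L2 →L[ℂ] ℂ :=
  innerSL ℂ (invSub (starRingEnd ℂ z) (by simpa using hz))

theorem cauchyL_apply (z : ℂ) (hz : z.im ≠ 0) (f : L2) :
    cauchyL z hz f = cauchyTransform f z := by
  rw [cauchyL, innerSL_apply_apply, L2.inner_def, cauchyTransform]
  refine integral_congr_ae ?_
  filter_upwards [coeFn_invSub (starRingEnd ℂ z) (by simpa using hz)] with x hx
  rw [hx]
  simp only [RCLike.inner_apply, map_inv₀, map_sub, Complex.conj_ofReal, Complex.conj_conj]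
  ring

/-! ### The trace Γ₁ of the explicit solutions -/

/-- The limit of `∫_{-R}^R dx / (x - z)`. -/
def traceConst (z : ℂ) : ℂ := if 0 < z.im then Real.pi * Complex.I else -(Real.pi * Complex.I)

theorem tendsto_div_atTop_zero (z : ℂ) : Tendsto (fun R : ℝ => z / (R : ℂ)) atTop (𝓝 0) := by
  have h1 : Tendsto (fun R : ℝ => ((R⁻¹ : ℝ) : ℂ)) atTop (𝓝 ((0 : ℝ) : ℂ)) :=
    (Complex.continuous_ofReal.tendsto 0).comp tendsto_inv_atTop_zero
  have h2 := h1.const_mul z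
  simp only [Complex.ofReal_zero, mul_zero, Complex.ofReal_inv] at h2
  simpa only [div_eq_mul_inv] using h2

/-- The logarithm is a primitive off the real line. After factoring out R at both endpoints the
terms log R cancel, leaving log(1 - z/R) - log(-1 - z/R). -/
theorem tendsto_integral_inv_sub_of_pos {z : ℂ} (hz : 0 < z.im) :
    Tendsto (fun R : ℝ => ∫ x in (-R)..R, ((x : ℂ) - z)⁻¹) atTop (𝓝 (Real.pi * Complex.I)) := by
  have hFTC : ∀ R : ℝ, ∫ x in (-R)..R, ((x : ℂ) - z)⁻¹ =
      Complex.log ((R : ℂ) - z) - Complex.log (((-R : ℝ) : ℂ) - z) := by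
    intro R
    refine intervalIntegral.integral_eq_sub_of_hasDerivAt
      (f := fun x : ℝ => Complex.log ((x : ℂ) - z)) (fun x _ => ?_) ?_
    · have h1 : HasDerivAt (fun x : ℝ => (x : ℂ) - z) 1 x :=
        (Complex.ofRealCLM.hasDerivAt (x := x)).sub_const z
      have := h1.clog_real (Or.inr (by simpa using hz.ne'))
      simpa using this
    · refine Continuous.intervalIntegrable ?_ _ _
      exact Continuous.inv₀ (by fun_prop) (sub_ofReal_ne_zero hz.ne')
  have hsplit : ∀ᶠ R : ℝ in atTop, Complex.log (1 - z / R) - Complex.log (-1 - z / R) =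
      ∫ x in (-R)..R, ((x : ℂ) - z)⁻¹ := by
    filter_upwards [eventually_gt_atTop 0] with R hR
    have hRc : (R : ℂ) ≠ 0 := by exact_mod_cast hR.ne'
    have e1 : (R : ℂ) - z = R * (1 - z / R) := by field_simp
    have e2 : ((-R : ℝ) : ℂ) - z = R * (-1 - z / R) := by push_cast; field_simp
    have n1 : (1 - z / R : ℂ) ≠ 0 := fun h => by
      rw [h, mul_zero] at e1; exact sub_ofReal_ne_zero hz.ne' R e1
    have n2 : (-1 - z / R : ℂ) ≠ 0 := fun h => by
      rw [h, mul_zero] at e2; exact sub_ofReal_ne_zero hz.ne' (-R) e2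
    rw [hFTC, e1, e2, Complex.log_ofReal_mul hR n1, Complex.log_ofReal_mul hR n2]
    ring
  refine Tendsto.congr' hsplit ?_
  have h0 := tendsto_div_atTop_zero z
  have l1 : Tendsto (fun R : ℝ => Complex.log (1 - z / R)) atTop (𝓝 0) := by
    have h1 : Tendsto (fun R : ℝ => 1 - z / (R : ℂ)) atTop (𝓝 1) := by
      simpa using h0.const_sub 1
    have := h1.clog (by simp)
    simpa using this
  have l2 : Tendsto (fun R : ℝ => Complex.log (-1 - z / R)) atTop (𝓝 (-(Real.pi * Complex.I))) := by
    -- With Im z > 0 the point -1 on the branch cut is approached from below, where the logarithm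
    -- tends to -πi.
    have h1 : Tendsto (fun R : ℝ => -1 - z / (R : ℂ)) atTop (𝓝[{w | w.im < 0}] (-1)) := by
      refine tendsto_nhdsWithin_iff.2 ⟨by simpa using h0.const_sub (-1), ?_⟩
      filter_upwards [eventually_gt_atTop 0] with R hR
      simp only [Complex.sub_im, Complex.neg_im, Complex.one_im,
        Complex.div_ofReal_im]
      have : 0 < z.im / R := by positivity
      linarith
    have := (Complex.tendsto_log_nhdsWithin_im_neg_of_re_neg_of_im_zero
      (z := -1) (by simp) (by simp)).comp h1
    simp only [norm_neg, norm_one, Real.log_one, Complex.ofReal_zero, zero_sub] at this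
    exact this
  simpa using l1.sub l2

theorem tendsto_integral_inv_sub {z : ℂ} (hz : z.im ≠ 0) :
    Tendsto (fun R : ℝ => ∫ x in (-R)..R, ((x : ℂ) - z)⁻¹) atTop (𝓝 (traceConst z)) := by
  rcases lt_or_gt_of_ne hz with h | h
  · have h1 := (Complex.continuous_conj.tendsto _).comp
      (tendsto_integral_inv_sub_of_pos (z := starRingEnd ℂ z) (by simpa using h))
    have h2 : starRingEnd ℂ (Real.pi * Complex.I) = traceConst z := by
      simp [traceConst, not_lt.2 h.le]
    rw [h2] at h1
    refine h1.congr fun R => ?_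
    simp only [Function.comp_def, intervalIntegral]
    rw [map_sub, ← integral_conj, ← integral_conj]
    simp
  · simpa [traceConst, h] using tendsto_integral_inv_sub_of_pos h

theorem intervalIntegrable_L2 (f : L2) (a b : ℝ) : IntervalIntegrable f volume a b := by
  have h : LocallyIntegrable f volume := (Lp.memLp f).locallyIntegrable (by norm_num)
  exact (h.integrableOn_isCompact isCompact_uIcc).intervalIntegrable

theorem TraceOneRel.add {u v : L2} {a b : ℂ} (hu : TraceOneRel u a) (hv : TraceOneRel v b) :
    TraceOneRel (u + v) (a + b) := by
  refine (Tendsto.add hu hv).congr fun R => ?_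
  rw [← intervalIntegral.integral_add (intervalIntegrable_L2 u _ _) (intervalIntegrable_L2 v _ _)]
  refine intervalIntegral.integral_congr_ae ?_
  filter_upwards [Lp.coeFn_add u v] with x hx _
  rw [hx]; rfl

theorem TraceOneRel.smul {u : L2} {a : ℂ} (c : ℂ) (hu : TraceOneRel u a) :
    TraceOneRel (c • u) (c * a) := by
  refine (Tendsto.const_mul c hu).congr fun R => ?_
  rw [← intervalIntegral.integral_const_mul]
  refine intervalIntegral.integral_congr_ae ?_
  filter_upwards [Lp.coeFn_smul c u] with x hx _
  rw [hx]; rfl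

theorem traceOneRel_invSub {z : ℂ} (hz : z.im ≠ 0) : TraceOneRel (invSub z hz) (traceConst z) := by
  refine (tendsto_integral_inv_sub hz).congr fun R => ?_
  refine intervalIntegral.integral_congr_ae ?_
  filter_upwards [coeFn_invSub z hz] with x hx _
  rw [hx]

theorem traceOneRel_mulInv {z : ℂ} (hz : z.im ≠ 0) (f : L2) :
    TraceOneRel (mulInv z hz f) (cauchyL z hz f) := by
  rw [cauchyL_apply]
  refine (intervalIntegral_tendsto_integral ((adm_L2 f).integrable_div hz) tendsto_neg_atTop_atBot
    tendsto_id).congr fun R => ?_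
  refine intervalIntegral.integral_congr_ae ?_
  filter_upwards [coeFn_mulInv z hz f] with x hx _
  rw [hx, div_eq_mul_inv]

/-! ### The resolvent set and the solutions in explicit form -/

theorem adjointRel_iff {φ ψ u w : L2} {c z : ℂ} (hz : z.im ≠ 0) :
    AdjointRel φ ψ u c (w + z • u) ↔
      u = c • invSub z hz + mulInv z hz (w - inner ℂ φ u • ψ) := by
  set q : ℂ := inner ℂ φ u with hq
  have hae : ∀ᵐ x : ℝ, (w + z • u : L2) x = w x + z * u x ∧
      (c • invSub z hz + mulInv z hz (w - q • ψ) : L2) x =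
        (c + w x - q * ψ x) * ((x : ℂ) - z)⁻¹ := by
    filter_upwards [Lp.coeFn_add w (z • u), Lp.coeFn_smul z u,
      Lp.coeFn_add (c • invSub z hz) (mulInv z hz (w - q • ψ)), Lp.coeFn_smul c (invSub z hz),
      coeFn_invSub z hz, coeFn_mulInv z hz (w - q • ψ), Lp.coeFn_sub w (q • ψ),
      Lp.coeFn_smul q ψ] with x h1 h2 h3 h4 h5 h6 h7 h8
    rw [h1, h3, Pi.add_apply, Pi.add_apply, h2, h4, h6, h7, Pi.sub_apply, h8, Pi.smul_apply,
      Pi.smul_apply, Pi.smul_apply, h5]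
    simp only [smul_eq_mul]
    exact ⟨trivial, by ring⟩
  have hpt : ∀ x : ℝ, (w x + z * u x = x * u x - c + q * ψ x ↔
      u x = (c + w x - q * ψ x) * ((x : ℂ) - z)⁻¹) := by
    intro x
    have hne := sub_ofReal_ne_zero hz x
    rw [eq_mul_inv_iff_mul_eq₀ hne]
    constructor
    · intro h; linear_combination -h
    · intro h; linear_combination -h
  constructor
  · intro h
    refine Lp.ext ?_
    filter_upwards [hae, h] with x h1 h2
    rw [h1.1] at h2
    rw [h1.2]
    exact (hpt x).1 h2
  · intro h
    have h' : ∀ᵐ x : ℝ, u x = (c • invSub z hz + mulInv z hz (w - q • ψ) : L2) x :=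
      Eventually.of_forall fun x => by rw [← h]
    filter_upwards [hae, h'] with x h1 h2
    rw [h1.1]
    rw [h1.2] at h2
    exact (hpt x).2 h2

theorem traceOneRel_resolvent_form {z : ℂ} (hz : z.im ≠ 0) (c : ℂ) (v : L2) :
    TraceOneRel (c • invSub z hz + mulInv z hz v) (c * traceConst z + cauchyL z hz v) :=
  ((traceOneRel_invSub hz).smul c).add (traceOneRel_mulInv hz v)

/-- Once `u` is in explicit form its trace is forced, and the boundary condition becomes a linear
equation in `c` and ⟨u, φ⟩. -/
theorem mem_graphAB_iff {φ ψ u f : L2} {B z : ℂ} (hz : z.im ≠ 0) :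
    (u, f + z • u) ∈ graphAB φ ψ B ↔
      ∃ c : ℂ, u = c • invSub z hz + mulInv z hz (f - inner ℂ φ u • ψ) ∧
        (traceConst z - B) * c + cauchyL z hz (f - inner ℂ φ u • ψ) = 0 := by
  constructor
  · rintro ⟨a, c, h1, h2, h3⟩
    have h4 := (adjointRel_iff hz).1 h1
    refine ⟨c, h4, ?_⟩
    have h5 : TraceOneRel u (c * traceConst z + cauchyL z hz (f - inner ℂ φ u • ψ)) := by
      have := traceOneRel_resolvent_form hz c (f - inner ℂ φ u • ψ)
      rwa [← h4] at this
    have h6 : a = _ := tendsto_nhds_unique h2 h5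
    rw [h6] at h3
    linear_combination h3
  · rintro ⟨c, h1, h2⟩
    refine ⟨c * traceConst z + cauchyL z hz (f - inner ℂ φ u • ψ), c,
      (adjointRel_iff hz).2 h1, ?_, ?_⟩
    · have := traceOneRel_resolvent_form hz c (f - inner ℂ φ u • ψ)
      rwa [← h1] at this
    · linear_combination h2

/-- `S_{z,B} f = u`. -/
def SolvesAt (φ ψ : L2) (B z f : ℂ) (u : L2) : Prop :=
  ∃ a c : ℂ, AdjointRel φ ψ u c (z • u) ∧ TraceOneRel u a ∧ a - B * c = f

theorem solvesAt_iff {φ ψ u : L2} {B z f : ℂ} (hz : z.im ≠ 0) :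
    SolvesAt φ ψ B z f u ↔ ∃ c : ℂ, u = c • invSub z hz - inner ℂ φ u • mulInv z hz ψ ∧
      f = (traceConst z - B) * c - inner ℂ φ u * cauchyL z hz ψ := by
  have hform : ∀ c : ℂ, c • invSub z hz + mulInv z hz (0 - inner ℂ φ u • ψ) =
      c • invSub z hz - inner ℂ φ u • mulInv z hz ψ := fun c => by
    rw [zero_sub, map_neg, map_smul, sub_eq_add_neg]
  have htr : ∀ c : ℂ, TraceOneRel (c • invSub z hz - inner ℂ φ u • mulInv z hz ψ)
      (c * traceConst z - inner ℂ φ u * cauchyL z hz ψ) := fun c => by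
    have := traceOneRel_resolvent_form hz c (0 - inner ℂ φ u • ψ)
    rwa [hform, zero_sub, map_neg, map_smul, smul_eq_mul, ← sub_eq_add_neg] at this
  constructor
  · rintro ⟨a, c, h1, h2, h3⟩
    rw [← zero_add (z • u), adjointRel_iff hz, hform] at h1
    refine ⟨c, h1, ?_⟩
    have h5 := htr c
    rw [← h1] at h5
    have h6 : a = _ := tendsto_nhds_unique h2 h5
    rw [← h3, h6]; ring
  · rintro ⟨c, h1, h2⟩
    refine ⟨c * traceConst z - inner ℂ φ u * cauchyL z hz ψ, c, ?_, ?_, ?_⟩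
    · rw [← zero_add (z • u), adjointRel_iff hz, hform]; exact h1
    · have h5 := htr c
      rwa [← h1] at h5
    · rw [h2]; ring

theorem inner_resolvent_form (φ ψ f : L2) {z : ℂ} (hz : z.im ≠ 0) (c q : ℂ) :
    inner ℂ φ (c • invSub z hz + mulInv z hz (f - q • ψ)) =
      c * inner ℂ φ (invSub z hz) + inner ℂ φ (mulInv z hz f) - q * (D φ ψ z - 1) := by
  rw [map_sub, map_smul, inner_add_right, inner_sub_right, inner_smul_right, inner_smul_right,
    inner_mulInv_self_sub φ ψ]
  ring

/-- The perturbation determinant of `A_B`. -/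
def pertDet (φ ψ : L2) (B z : ℂ) (hz : z.im ≠ 0) : ℂ :=
  D φ ψ z * (traceConst z - B) - inner ℂ φ (invSub z hz) * cauchyL z hz ψ

/-- The unknowns q and c satisfy Dq - Fc = N f and bc - Pq = -f^(z), a system with determinant
`pertDet`. Cramer's rule makes both of them bounded functionals of f, which gives a bounded inverse.
-/
theorem mem_resolventSetAB {φ ψ : L2} {B z : ℂ} (hz : z.im ≠ 0) (hdet : pertDet φ ψ B z hz ≠ 0) :
    z ∈ resolventSetAB φ ψ B := by
  set Δ := pertDet φ ψ B z hz with hΔ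
  set d := D φ ψ z
  set b := traceConst z - B
  set F : ℂ := inner ℂ φ (invSub z hz) with hF
  set P := cauchyL z hz ψ
  have hΔ' : Δ = d * b - F * P := rfl
  set N : L2 →L[ℂ] ℂ := (innerSL ℂ φ).comp (mulInv z hz) with hN
  have hNa : ∀ f, N f = inner ℂ φ (mulInv z hz f) := fun f => rfl
  set q : L2 →L[ℂ] ℂ := Δ⁻¹ • (b • N - F • cauchyL z hz) with hq
  set c : L2 →L[ℂ] ℂ := Δ⁻¹ • (P • N - d • cauchyL z hz) with hc
  have hqa : ∀ f, q f = Δ⁻¹ * (b * N f - F * cauchyL z hz f) := fun f => rfl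
  have hca : ∀ f, c f = Δ⁻¹ * (P * N f - d * cauchyL z hz f) := fun f => rfl
  refine ⟨c.smulRight (invSub z hz) +
    (mulInv z hz).comp (ContinuousLinearMap.id ℂ L2 - q.smulRight ψ), fun u f => ?_⟩
  have hR : (c.smulRight (invSub z hz) +
      (mulInv z hz).comp (ContinuousLinearMap.id ℂ L2 - q.smulRight ψ)) f =
      c f • invSub z hz + mulInv z hz (f - q f • ψ) := by
    simp
  rw [hR, mem_graphAB_iff hz]
  constructor
  · rintro ⟨c₀, h1, h2⟩
    have h3 := inner_resolvent_form φ ψ f hz c₀ (inner ℂ φ u)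
    rw [← h1] at h3
    set q₀ : ℂ := inner ℂ φ u
    rw [map_sub, map_smul, smul_eq_mul] at h2
    have e1 : q₀ = q f := by
      rw [hqa, eq_inv_mul_iff_mul_eq₀ hdet, hΔ', hNa]
      linear_combination b * h3 + F * h2
    have e2 : c₀ = c f := by
      rw [hca, eq_inv_mul_iff_mul_eq₀ hdet, hΔ', hNa]
      linear_combination P * h3 + d * h2
    rw [← e1, ← e2]; exact h1
  · intro h
    have h3 := inner_resolvent_form φ ψ f hz (c f) (q f)
    rw [← h, ← hNa] at h3
    have hmul : Δ⁻¹ * (d * b - F * P) = 1 := by rw [← hΔ']; exact inv_mul_cancel₀ hdet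
    have e1 : inner ℂ φ u = q f := by
      rw [h3, hca, hqa]
      linear_combination -(N f) * hmul
    refine ⟨c f, by rw [e1]; exact h, ?_⟩
    rw [e1, map_sub, map_smul, smul_eq_mul, hca, hqa]
    linear_combination -(cauchyL z hz f) * hmul

theorem invSub_ne_zero {z : ℂ} (hz : z.im ≠ 0) : invSub z hz ≠ 0 := by
  intro h
  have h1 := coeFn_invSub z hz
  rw [h] at h1
  obtain ⟨x, hx1, hx2⟩ := (h1.and (Lp.coeFn_zero ℂ 2 (volume : Measure ℝ))).exists
  rw [hx2] at hx1
  exact inv_ne_zero (sub_ofReal_ne_zero hz x) hx1.symm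

theorem pertDet_ne_zero {φ ψ : L2} {B z : ℂ} (hz : z.im ≠ 0) (h : z ∈ resolventSetAB φ ψ B) :
    pertDet φ ψ B z hz ≠ 0 := by
  intro h0
  obtain ⟨R, hR⟩ := h
  set d := D φ ψ z
  set b := traceConst z - B
  set F : ℂ := inner ℂ φ (invSub z hz) with hF
  set P := cauchyL z hz ψ
  have hΔ' : d * b - F * P = 0 := h0
  -- A nonzero kernel vector of the singular 2×2 matrix, found by cases on its vanishing entries. It
  -- yields a solution of the homogeneous equation, which injectivity forces to be 0, although (q,
  -- c) is recovered from that solution.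
  obtain ⟨q, c, hqc, e1, e2⟩ : ∃ q c : ℂ, (q ≠ 0 ∨ c ≠ 0) ∧ d * q = c * F ∧ b * c = q * P := by
    by_cases hb : b = 0
    · by_cases hP : P = 0
      · by_cases hd : d = 0
        · by_cases hF0 : F = 0
          · exact ⟨1, 0, Or.inl one_ne_zero, by simp [hd], by simp [hP]⟩
          · exact ⟨F, d, Or.inl hF0, by ring, by simp [hb, hP]⟩
        · exact ⟨F, d, Or.inr hd, by ring, by simp [hb, hP]⟩
      · exact ⟨b, P, Or.inr hP, by linear_combination hΔ', by ring⟩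
    · exact ⟨b, P, Or.inl hb, by linear_combination hΔ', by ring⟩
  set u := c • invSub z hz + mulInv z hz (0 - q • ψ) with hu
  have h3 := inner_resolvent_form φ ψ 0 hz c q
  rw [← hu, map_zero, inner_zero_right] at h3
  have h4 : inner ℂ φ u = q := by rw [h3]; linear_combination -e1
  have h5 : (u, 0 + z • u) ∈ graphAB φ ψ B := by
    rw [mem_graphAB_iff hz]
    refine ⟨c, by rw [h4], ?_⟩
    rw [h4, zero_sub, map_neg, map_smul, smul_eq_mul]
    linear_combination e2
  have h6 : u = 0 := by rw [(hR u 0).1 h5, map_zero]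
  have hq0 : q = 0 := by rw [← h4, h6, inner_zero_right]
  have hc0 : c = 0 := by
    rw [hu, hq0, zero_smul, sub_zero, map_zero, add_zero] at h6
    exact (smul_eq_zero.1 h6).resolve_right (invSub_ne_zero hz)
  rcases hqc with h | h
  · exact h hq0
  · exact h hc0

/-! ### Changing the spectral parameter -/

theorem AdjointRel.add {φ ψ u v w y : L2} {c e : ℂ} (h1 : AdjointRel φ ψ u c w)
    (h2 : AdjointRel φ ψ v e y) : AdjointRel φ ψ (u + v) (c + e) (w + y) := by
  filter_upwards [h1, h2, Lp.coeFn_add u v, Lp.coeFn_add w y] with x h1 h2 h3 h4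
  rw [h3, h4, Pi.add_apply, Pi.add_apply, h1, h2, inner_add_right]
  ring

theorem AdjointRel.smul {φ ψ u w : L2} {c : ℂ} (s : ℂ) (h1 : AdjointRel φ ψ u c w) :
    AdjointRel φ ψ (s • u) (s * c) (s • w) := by
  filter_upwards [h1, Lp.coeFn_smul s u, Lp.coeFn_smul s w] with x h1 h3 h4
  rw [h3, h4, Pi.smul_apply, Pi.smul_apply, h1, inner_smul_right]
  simp only [smul_eq_mul]
  ring

/-- Adding (δ - z)v, with v = (A_B - δ)⁻¹u, moves the eigenvalue from z to δ; since v satisfies the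
boundary condition, the datum f is unchanged. -/
theorem SolvesAt.shift {φ ψ u v : L2} {B z δ f : ℂ} (hu : SolvesAt φ ψ B z f u)
    (hv : (v, u + δ • v) ∈ graphAB φ ψ B) : SolvesAt φ ψ B δ f (u + (δ - z) • v) := by
  obtain ⟨a, c, h1, h2, h3⟩ := hu
  obtain ⟨a', c', h1', h2', h3'⟩ := hv
  refine ⟨a + (δ - z) * a', c + (δ - z) * c', ?_, h2.add (h2'.smul _), ?_⟩
  · have := h1.add (h1'.smul (δ - z))
    convert this using 1
    simp only
    module
  · linear_combination h3 + (δ - z) * h3'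

theorem exists_mem_graphAB {φ ψ : L2} {B z : ℂ} (hz : z ∈ resolventSetAB φ ψ B) (f : L2) :
    ∃ v, (v, f + z • v) ∈ graphAB φ ψ B := by
  obtain ⟨R, hR⟩ := hz
  exact ⟨R f, (hR _ _).2 rfl⟩

/-- Neumann series: solutions of the resolvent equation depend continuously on the spectral
parameter. -/
theorem exists_tendsto_mem_graphAB {φ ψ u v : L2} {B z : ℂ} (hz : z ∈ resolventSetAB φ ψ B)
    (hv : (v, u + z • v) ∈ graphAB φ ψ B) :
    ∃ w : ℂ → L2, Tendsto w (𝓝 0) (𝓝 v) ∧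
      ∀ᶠ s in 𝓝 (0 : ℂ), z + s ∈ resolventSetAB φ ψ B ∧
        (w s, u + (z + s) • w s) ∈ graphAB φ ψ B := by
  obtain ⟨R, hR⟩ := hz
  set T : ℂ → L2 →L[ℂ] L2 := fun s => 1 - s • R with hT
  have hTc : Continuous T := by fun_prop
  have hT0 : T 0 = ((1 : (L2 →L[ℂ] L2)ˣ) : L2 →L[ℂ] L2) := by simp [hT]
  have hunit : ∀ᶠ s in 𝓝 (0 : ℂ), IsUnit (T s) := by
    have := (Units.isOpen (R := L2 →L[ℂ] L2)).mem_nhds (x := T 0) (by rw [hT0]; exact isUnit_one)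
    exact hTc.continuousAt.eventually this
  have hinv : Tendsto (fun s => Ring.inverse (T s)) (𝓝 0) (𝓝 1) := by
    have h1 := NormedRing.inverse_continuousAt (1 : (L2 →L[ℂ] L2)ˣ)
    rw [← hT0] at h1
    have h2 := h1.tendsto.comp (hTc.tendsto 0)
    have h3 : Ring.inverse (T 0) = 1 := by rw [hT0]; simp
    rw [h3] at h2
    exact h2
  have hv' : v = R u := (hR v u).1 hv
  refine ⟨fun s => Ring.inverse (T s) (R u), ?_, ?_⟩
  · have h1 : Continuous fun S : L2 →L[ℂ] L2 => S (R u) := by fun_prop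
    have := (h1.tendsto 1).comp hinv
    rw [hv']
    exact this
  · filter_upwards [hunit] with s hs
    -- Moving s•w to the right-hand side turns the relation at z + s into w = R(f + s•w), that is,
    -- (1 - sR)w = Rf.
    have key : ∀ w f : L2, (w, f + (z + s) • w) ∈ graphAB φ ψ B ↔
        w = (Ring.inverse (T s)).comp R f := by
      intro w f
      have e1 : f + (z + s) • w = (f + s • w) + z • w := by module
      rw [e1, hR, ContinuousLinearMap.comp_apply]
      have hl : ∀ x, T s (Ring.inverse (T s) x) = x := fun x => by
        have := congrArg (fun S : L2 →L[ℂ] L2 => S x) (Ring.mul_inverse_cancel (T s) hs)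
        simpa using this
      have hr : ∀ x, Ring.inverse (T s) (T s x) = x := fun x => by
        have := congrArg (fun S : L2 →L[ℂ] L2 => S x) (Ring.inverse_mul_cancel (T s) hs)
        simpa using this
      have hTa : ∀ x, T s x = x - s • R x := fun x => by simp [hT]
      constructor
      · intro h
        have h2 : T s w = R f := by
          rw [hTa, sub_eq_iff_eq_add]
          conv_lhs => rw [h]
          rw [map_add, map_smul]
        rw [← h2, hr]
      · intro h
        have h2 : T s w = R f := by rw [h, hl]
        rw [hTa, sub_eq_iff_eq_add] at h2
        rw [map_add, map_smul]
        exact h2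
    exact ⟨⟨_, key⟩, (key _ _).2 rfl⟩

/-! ### Boundary values of D, and the criterion as a holomorphic identity -/

theorem integrable_mul_conj (f g : L2) :
    Integrable fun x : ℝ => f x * starRingEnd ℂ (g x) := by
  simpa only [RCLike.inner_apply] using L2.integrable_inner (𝕜 := ℂ) g f

theorem adm_mul_conj (f g : L2) : Adm fun x : ℝ => f x * starRingEnd ℂ (g x) :=
  adm_of_integrable (integrable_mul_conj f g)

theorem adm_conj (g : L2) : Adm fun x : ℝ => starRingEnd ℂ (g x) := by
  refine (adm_L2 g).mono (Complex.continuous_conj.comp_aestronglyMeasurable (Lp.memLp g).1)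
    fun x => ?_
  rw [RCLike.norm_conj]

theorem cauchyTransform_conj (g : ℝ → ℂ) (z : ℂ) :
    cauchyTransform (fun x => starRingEnd ℂ (g x)) z =
      starRingEnd ℂ (cauchyTransform g (starRingEnd ℂ z)) := by
  rw [conj_cauchyTransform, Complex.conj_conj]

theorem cauchyTransform_mul_conj (f g : ℝ → ℂ) (z : ℂ) :
    cauchyTransform (fun x => f x * starRingEnd ℂ (g x)) z =
      starRingEnd ℂ (cauchyTransform (fun x => g x * starRingEnd ℂ (f x)) (starRingEnd ℂ z)) := by
  rw [← cauchyTransform_conj]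
  simp [mul_comm]

/-- Reflection in the real line exchanges φ and ψ, so limits from below reduce to limits from above,
where the uniqueness theory applies. -/
theorem D_eq_conj (φ ψ : L2) (z : ℂ) : D φ ψ z = starRingEnd ℂ (D ψ φ (starRingEnd ℂ z)) := by
  rw [D, D, cauchyTransform_mul_conj, map_add, map_one]

theorem conj_vertical (k ε : ℝ) :
    starRingEnd ℂ (k - ε * Complex.I) = k + ε * Complex.I := by
  simp

theorem nev_D (φ ψ : L2) : Nev (D φ ψ) :=
  (nev_const 1).add (nev_cauchyTransform (adm_mul_conj ψ φ))

/-- The transform of an integrable density is at most its L¹ norm divided by t at it, so it cannot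
equal -1 for large t. -/
theorem eventually_D_ne_zero (φ ψ : L2) : ∀ᶠ t : ℝ in atTop, D φ ψ (t * Complex.I) ≠ 0 := by
  set N := ∫ x, ‖ψ x * starRingEnd ℂ (φ x)‖ with hN
  have hN0 : 0 ≤ N := integral_nonneg fun _ => norm_nonneg _
  filter_upwards [eventually_gt_atTop N] with t ht h
  have ht0 : 0 < t := hN0.trans_lt ht
  have h1 := norm_cauchyTransform_le (integrable_mul_conj ψ φ) (z := t * Complex.I)
    (by simpa using ht0.ne')
  have h2 : cauchyTransform (fun x => ψ x * starRingEnd ℂ (φ x)) (t * Complex.I) = -1 := by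
    rw [D] at h; linear_combination h
  rw [h2, norm_neg, norm_one, ← hN] at h1
  simp only [Complex.mul_im, Complex.ofReal_re, Complex.I_im, mul_one, Complex.ofReal_im,
    Complex.I_re, mul_zero, add_zero, abs_of_pos ht0] at h1
  rw [le_div_iff₀ ht0] at h1
  linarith

theorem ae_tendsto_D_upper (φ ψ : L2) : ∀ᵐ k : ℝ, ∃ d : ℂ, d ≠ 0 ∧
    Tendsto (fun ε : ℝ => D φ ψ (k + ε * Complex.I)) (𝓝[>] 0) (𝓝 d) := by
  obtain ⟨t, ht, ht0⟩ := ((eventually_D_ne_zero φ ψ).and (eventually_gt_atTop 0)).exists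
  exact (nev_D φ ψ).ae_tendsto_ne_zero (z := t * Complex.I) (by simpa [uhp] using ht0) ht

theorem ae_tendsto_D_lower (φ ψ : L2) : ∀ᵐ k : ℝ, ∃ d : ℂ, d ≠ 0 ∧
    Tendsto (fun ε : ℝ => D φ ψ (k - ε * Complex.I)) (𝓝[>] 0) (𝓝 d) := by
  filter_upwards [ae_tendsto_D_upper ψ φ] with k ⟨d, hd, hk⟩
  refine ⟨starRingEnd ℂ d, (map_ne_zero _).2 hd, ?_⟩
  refine ((Complex.continuous_conj.tendsto d).comp hk).congr fun ε => ?_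
  rw [D_eq_conj φ ψ, conj_vertical]; rfl

theorem ae_tendsto_cauchyTransform_lower (ψ g : L2) : ∀ᵐ k : ℝ, ∃ p : ℂ,
    Tendsto (fun ε : ℝ => cauchyTransform (fun x => ψ x * starRingEnd ℂ (g x))
      (k - ε * Complex.I)) (𝓝[>] 0) (𝓝 p) := by
  filter_upwards [(nev_cauchyTransform (adm_mul_conj g ψ)).ae_tendsto] with k ⟨d, hk⟩
  refine ⟨starRingEnd ℂ d, ?_⟩
  refine ((Complex.continuous_conj.tendsto d).comp hk).congr fun ε => ?_
  rw [cauchyTransform_mul_conj, conj_vertical]; rfl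

theorem ae_tendsto_cauchyTransform_conj_hardyPlus {g : L2} (hg : g ∈ hardyPlus) :
    ∀ᵐ k : ℝ, Tendsto (fun ε : ℝ => cauchyTransform (fun x => starRingEnd ℂ (g x))
      (k - ε * Complex.I)) (𝓝[>] 0) (𝓝 (-(2 * Real.pi * Complex.I) * starRingEnd ℂ (g k))) := by
  filter_upwards [ae_tendsto_cauchyTransform_hardyPlus hg] with k hk
  have h1 := (Complex.continuous_conj.tendsto _).comp hk
  have h2 : starRingEnd ℂ (2 * Real.pi * Complex.I * g k) =
      -(2 * Real.pi * Complex.I) * starRingEnd ℂ (g k) := by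
    simp only [map_mul, Complex.conj_ofReal, Complex.conj_I, Complex.conj_ofNat]
    ring
  rw [h2] at h1
  refine h1.congr fun ε => ?_
  rw [cauchyTransform_conj, conj_vertical]; rfl

theorem cauchyTransform_conj_eq_zero {g : L2} (hg : g ∈ hardyPlus) {z : ℂ} (hz : 0 < z.im) :
    cauchyTransform (fun x => starRingEnd ℂ (g x)) z = 0 := by
  rw [cauchyTransform_conj, cauchyTransform_eq_zero_of_hardyPlus hg (by simpa using hz), map_zero]

/-- For `g ∈ H₂⁺`, condition (II) is an identity between holomorphic functions in the lower
half-plane. -/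
theorem criterion_iff {φ ψ g : L2} (hφ : φ ∈ hardyPlus) (hg : g ∈ hardyPlus) :
    Criterion φ ψ g ↔ ∀ z : ℂ, z.im < 0 → D φ ψ z ≠ 0 →
      D φ ψ z * cauchyTransform (fun x => starRingEnd ℂ (g x)) z =
        cauchyTransform (fun x => starRingEnd ℂ (φ x)) z *
          cauchyTransform (fun x => ψ x * starRingEnd ℂ (g x)) z := by
  -- The boundary value of left side minus right side is -2πi(conj g·D₋ - conj φ·p), where p is the
  -- limit of (ψ conj g)^. As D₋ ≠ 0, its vanishing is exactly (II).
  have hb : ∀ᵐ k : ℝ, ∃ e : ℂ, Tendsto (fun ε : ℝ =>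
      D φ ψ (k - ε * Complex.I) * cauchyTransform (fun x => starRingEnd ℂ (g x)) (k - ε * Complex.I) -
        cauchyTransform (fun x => starRingEnd ℂ (φ x)) (k - ε * Complex.I) *
          cauchyTransform (fun x => ψ x * starRingEnd ℂ (g x)) (k - ε * Complex.I)) (𝓝[>] 0) (𝓝 e) ∧
      (e = 0 ↔ starRingEnd ℂ (g k) =
        -(2 * Real.pi * Complex.I / Dminus φ ψ k) * starRingEnd ℂ (φ k) *
          rieszMinus (fun x => ψ x * starRingEnd ℂ (g x)) k) ∧
      ∀ᶠ ε : ℝ in 𝓝[>] 0, D φ ψ (k - ε * Complex.I) ≠ 0 := by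
    filter_upwards [ae_tendsto_D_lower φ ψ, ae_tendsto_cauchyTransform_lower ψ g,
      ae_tendsto_cauchyTransform_conj_hardyPlus hg, ae_tendsto_cauchyTransform_conj_hardyPlus hφ]
      with k ⟨d, hd0, hd⟩ ⟨p, hp⟩ hgk hφk
    refine ⟨_, (hd.mul hgk).sub (hφk.mul hp), ?_, hd.eventually_ne hd0⟩
    have e1 : Dminus φ ψ k = d := hd.limUnder_eq
    have e2 : rieszMinus (fun x => ψ x * starRingEnd ℂ (g x)) k =
        -(1 / (2 * Real.pi * Complex.I)) * p := by
      rw [rieszMinus, lowerBoundaryValue, hp.limUnder_eq]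
    rw [e1, e2]
    have hpi := Complex.two_pi_I_ne_zero
    have e3 : -(2 * Real.pi * Complex.I / d) * starRingEnd ℂ (φ k) *
        (-(1 / (2 * Real.pi * Complex.I)) * p) = starRingEnd ℂ (φ k) * p / d := by
      have hpi' : (Real.pi : ℂ) ≠ 0 := by exact_mod_cast Real.pi_ne_zero
      field_simp
    rw [e3, eq_div_iff hd0, ← sub_eq_zero (a := starRingEnd ℂ (g k) * d)]
    have e4 : d * (-(2 * Real.pi * Complex.I) * starRingEnd ℂ (g k)) -
        -(2 * Real.pi * Complex.I) * starRingEnd ℂ (φ k) * p =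
        -(2 * Real.pi * Complex.I) * (starRingEnd ℂ (g k) * d - starRingEnd ℂ (φ k) * p) := by ring
    rw [e4, mul_eq_zero, or_iff_right (neg_ne_zero.2 hpi)]
  constructor
  · rintro ⟨-, hII⟩ z hz -
    -- The difference of the two sides, reflected into the upper half-plane. It is a quotient of
    -- bounded functions and (II) makes its boundary values zero.
    set E : ℂ → ℂ := fun z => D ψ φ z * cauchyTransform g z +
      (-1) * (cauchyTransform φ z * cauchyTransform (fun x => g x * starRingEnd ℂ (ψ x)) z) with hE
    have hEn : Nev E := ((nev_D ψ φ).mul (nev_cauchyTransform (adm_L2 g))).add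
      ((nev_const (-1)).mul ((nev_cauchyTransform (adm_L2 φ)).mul
        (nev_cauchyTransform (adm_mul_conj g ψ))))
    have hconj : ∀ w : ℂ, starRingEnd ℂ (E (starRingEnd ℂ w)) =
        D φ ψ w * cauchyTransform (fun x => starRingEnd ℂ (g x)) w -
        cauchyTransform (fun x => starRingEnd ℂ (φ x)) w *
          cauchyTransform (fun x => ψ x * starRingEnd ℂ (g x)) w := by
      intro w
      rw [D_eq_conj, cauchyTransform_conj, cauchyTransform_conj, cauchyTransform_mul_conj ψ g]
      simp only [hE, map_add, map_mul, map_neg, map_one]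
      ring
    have hlim : ∀ᵐ k : ℝ, Tendsto (fun ε : ℝ => E (k + ε * Complex.I)) (𝓝[>] 0) (𝓝 0) := by
      filter_upwards [hb, hII] with k ⟨e, he, hiff, _⟩ hk
      rw [hiff.2 hk] at he
      have := (Complex.continuous_conj.tendsto _).comp he
      rw [map_zero] at this
      refine this.congr fun ε => ?_
      simp only [Function.comp_def]
      rw [← hconj, Complex.conj_conj, conj_vertical]
    have h0 := hEn.eq_zero_of_ae_tendsto_zero hlim (z := starRingEnd ℂ z) (by simpa [uhp] using hz)
    have h1 := hconj z
    rw [h0, map_zero] at h1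
    exact (sub_eq_zero.1 h1.symm)
  · intro h
    refine ⟨hg, ?_⟩
    filter_upwards [hb] with k ⟨e, he, hiff, hne⟩
    refine hiff.1 (tendsto_nhds_unique he ?_)
    refine tendsto_const_nhds.congr' ?_
    -- The identity is assumed only where D ≠ 0. This suffices: D has a nonzero limit at k, so it
    -- does not vanish close to k on the vertical line.
    filter_upwards [hne, self_mem_nhdsWithin] with ε hε0 hε
    have hε' : (0 : ℝ) < ε := hε
    rw [h _ (by simpa using hε') hε0, sub_self]

/-! ### Orthogonality to solutions when φ and ψ are in H₂⁺ -/

theorem traceConst_of_pos {z : ℂ} (hz : 0 < z.im) : traceConst z = Real.pi * Complex.I :=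
  if_pos hz

theorem traceConst_of_neg {z : ℂ} (hz : z.im < 0) : traceConst z = -(Real.pi * Complex.I) :=
  if_neg (not_lt.2 hz.le)

/-- In each half-plane one factor of the product term is zero: the transform of ψ below, that of
conj φ above. -/
theorem pertDet_eq {φ ψ : L2} (hφ : φ ∈ hardyPlus) (hψ : ψ ∈ hardyPlus) (B : ℂ) {z : ℂ}
    (hz : z.im ≠ 0) : pertDet φ ψ B z hz = D φ ψ z * (traceConst z - B) := by
  have : inner ℂ φ (invSub z hz) * cauchyL z hz ψ = 0 := by
    rcases lt_or_gt_of_ne hz with h | h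
    · rw [cauchyL_apply, cauchyTransform_eq_zero_of_hardyPlus hψ h, mul_zero]
    · rw [inner_invSub, cauchyTransform_conj_eq_zero hφ h, zero_mul]
  rw [pertDet, this, sub_zero]

theorem mem_resolventSetAB_of_D_ne_zero {φ ψ : L2} (hφ : φ ∈ hardyPlus) (hψ : ψ ∈ hardyPlus)
    {B : ℂ} (hB : B ≠ Real.pi * Complex.I) (hB' : B ≠ -(Real.pi * Complex.I)) {z : ℂ}
    (hz : z.im ≠ 0) (hD : D φ ψ z ≠ 0) : z ∈ resolventSetAB φ ψ B := by
  refine mem_resolventSetAB hz ?_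
  rw [pertDet_eq hφ hψ]
  refine mul_ne_zero hD (sub_ne_zero.2 ?_)
  rcases lt_or_gt_of_ne hz with h | h
  · rw [traceConst_of_neg h]; exact hB'.symm
  · rw [traceConst_of_pos h]; exact hB.symm

/-- `g` is orthogonal to the ranges of all solution operators `S_{μ,B}`, `μ ∈ ρ(A_B)`. -/
def OrthogonalToSolutions (φ ψ : L2) (B : ℂ) (g : L2) : Prop :=
  ∀ μ ∈ resolventSetAB φ ψ B, ∀ u ∈ solutionRange φ ψ B μ, inner ℂ u g = 0

theorem SolvesAt.mem_solutionRange {φ ψ u : L2} {B z f : ℂ} (h : SolvesAt φ ψ B z f u) :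
    u ∈ solutionRange φ ψ B z := ⟨f, h⟩

theorem inner_solution (ψ g : L2) {z : ℂ} (hz : z.im ≠ 0) (c q : ℂ) :
    inner ℂ g (c • invSub z hz - q • mulInv z hz ψ) =
      c * cauchyTransform (fun x => starRingEnd ℂ (g x)) z -
        q * cauchyTransform (fun x => ψ x * starRingEnd ℂ (g x)) z := by
  rw [inner_sub_right, inner_smul_right, inner_smul_right, inner_invSub, inner_mulInv]

theorem inner_mul_D {φ ψ u : L2} {c z : ℂ} (hz : z.im ≠ 0)
    (hu : u = c • invSub z hz - inner ℂ φ u • mulInv z hz ψ) :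
    inner ℂ φ u * D φ ψ z = c * cauchyTransform (fun x => starRingEnd ℂ (φ x)) z := by
  have h := congrArg (fun v => inner ℂ φ v) hu
  beta_reduce at h
  rw [inner_solution ψ φ] at h
  rw [D]
  linear_combination h

/-- Below the real line, D times the pairing is c times the identity of `criterion_iff`. Above it, q
= 0 and the transform of conj g vanishes, so both terms disappear. -/
theorem inner_solution_eq_zero {φ ψ g u : L2} (hφ : φ ∈ hardyPlus) (hψ : ψ ∈ hardyPlus)
    (hg : Criterion φ ψ g) {B μ : ℂ} (hμ0 : μ.im ≠ 0) (hμ : μ ∈ resolventSetAB φ ψ B)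
    (hu : u ∈ solutionRange φ ψ B μ) : inner ℂ u g = 0 := by
  obtain ⟨f, hf⟩ := hu
  obtain ⟨c, hc, -⟩ := (solvesAt_iff hμ0).1 hf
  have hD : D φ ψ μ ≠ 0 := by
    have := pertDet_ne_zero hμ0 hμ
    rw [pertDet_eq hφ hψ] at this
    exact left_ne_zero_of_mul this
  have hq := inner_mul_D hμ0 hc
  have hi := congrArg (fun v => inner ℂ g v) hc
  beta_reduce at hi
  rw [inner_solution ψ g] at hi
  rw [← inner_conj_symm, map_eq_zero, hi]
  rcases lt_or_gt_of_ne hμ0 with h | h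
  · refine (mul_eq_zero.1 ?_).resolve_left hD
    have := (criterion_iff hφ hg.1).1 hg μ h hD
    linear_combination c * this -
      cauchyTransform (fun x => ψ x * starRingEnd ℂ (g x)) μ * hq
  · rw [cauchyTransform_conj_eq_zero hφ h, mul_zero] at hq
    rw [(mul_eq_zero.1 hq).resolve_right hD, cauchyTransform_conj_eq_zero hg.1 h]
    ring

theorem tendsto_vertical_nhds_zero :
    Tendsto (fun t : ℝ => (t : ℂ) * Complex.I) (𝓝[>] 0) (𝓝 0) := by
  have h : Continuous fun t : ℝ => (t : ℂ) * Complex.I := by fun_prop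
  have := h.tendsto 0
  simp only [Complex.ofReal_zero, zero_mul] at this
  exact this.mono_left nhdsWithin_le_nhds

theorem Criterion.orthogonalToSolutions {φ ψ g : L2} (hφ : φ ∈ hardyPlus) (hψ : ψ ∈ hardyPlus)
    (hg : Criterion φ ψ g) (B : ℂ) : OrthogonalToSolutions φ ψ B g := by
  intro μ hμ u hu
  -- At a real μ the solution is the limit of solutions at μ + it, t ↓ 0, for which the pairing is
  -- already known to vanish.
  by_cases hμ0 : μ.im = 0
  · obtain ⟨f, hf⟩ := hu
    have hf : SolvesAt φ ψ B μ f u := hf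
    obtain ⟨v, hv⟩ := exists_mem_graphAB hμ u
    obtain ⟨w, hw, hev⟩ := exists_tendsto_mem_graphAB hμ hv
    have h1 : Tendsto (fun s : ℂ => inner ℂ (u + s • w s) g) (𝓝 0)
        (𝓝 (inner ℂ (u + (0 : ℂ) • v) g)) :=
      (tendsto_const_nhds.add (tendsto_id.smul hw)).inner tendsto_const_nhds
    rw [zero_smul, add_zero] at h1
    refine tendsto_nhds_unique (h1.comp tendsto_vertical_nhds_zero) ?_
    refine tendsto_const_nhds.congr' ?_
    filter_upwards [tendsto_vertical_nhds_zero.eventually hev, self_mem_nhdsWithin] with t ht ht0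
    have h2 := hf.shift ht.2
    rw [add_sub_cancel_left] at h2
    refine (inner_solution_eq_zero hφ hψ hg ?_ ht.1 h2.mem_solutionRange).symm
    simpa [hμ0] using (ne_of_gt ht0)
  · exact inner_solution_eq_zero hφ hψ hg hμ0 hμ hu

theorem OrthogonalToSolutions.criterion {φ ψ g : L2} (hφ : φ ∈ hardyPlus) (hψ : ψ ∈ hardyPlus)
    {B : ℂ} (hB : B ≠ Real.pi * Complex.I) (hB' : B ≠ -(Real.pi * Complex.I))
    (hg : OrthogonalToSolutions φ ψ B g) : Criterion φ ψ g := by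
  have key : ∀ z : ℂ, z.im ≠ 0 → D φ ψ z ≠ 0 →
      D φ ψ z * cauchyTransform (fun x => starRingEnd ℂ (g x)) z =
        cauchyTransform (fun x => starRingEnd ℂ (φ x)) z *
          cauchyTransform (fun x => ψ x * starRingEnd ℂ (g x)) z := by
    intro z hz hD
    have hρ := mem_resolventSetAB_of_D_ne_zero hφ hψ hB hB' hz hD
    set F := cauchyTransform (fun x => starRingEnd ℂ (φ x)) z
    -- The value that ⟨u, φ⟩ must have for the solution normalised by c = 1.
    set q : ℂ := F / D φ ψ z with hq
    set u : L2 := (1 : ℂ) • invSub z hz - q • mulInv z hz ψ with hu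
    have hqD : q * D φ ψ z = F := div_mul_cancel₀ _ hD
    have h1 : inner ℂ φ u = q := by
      rw [hu, inner_solution ψ φ]
      rw [D] at hqD
      linear_combination -hqD
    have h2 := hg z hρ u (((solvesAt_iff hz).2 ⟨1, by rw [h1], rfl⟩).mem_solutionRange)
    rw [← inner_conj_symm, map_eq_zero, hu, inner_solution ψ g] at h2
    linear_combination D φ ψ z * h2 +
      cauchyTransform (fun x => ψ x * starRingEnd ℂ (g x)) z * hqD
  -- The identity gives vanishing only off the zeros of D. As D ≠ 0 near almost every boundary point
  -- along the vertical, the boundary values are a.e. zero, and uniqueness covers the whole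
  -- half-plane.
  have hup : ∀ z ∈ uhp, cauchyTransform (fun x => starRingEnd ℂ (g x)) z = 0 := by
    intro z hz
    refine (nev_cauchyTransform (adm_conj g)).eq_zero_of_ae_tendsto_zero ?_ hz
    filter_upwards [ae_tendsto_D_upper φ ψ] with k ⟨d, hd0, hd⟩
    refine tendsto_const_nhds.congr' ?_
    filter_upwards [hd.eventually_ne hd0, self_mem_nhdsWithin] with ε hε hε0
    have hu := ofReal_add_mem_uhp k hε0
    have := key _ (ne_of_gt hu) hε
    rw [cauchyTransform_conj_eq_zero hφ hu, zero_mul] at this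
    exact ((mul_eq_zero.1 this).resolve_left hε).symm
  have hgH : g ∈ hardyPlus := by
    refine mem_hardyPlus_of_cauchyTransform_eq_zero fun ζ hζ => ?_
    have h1 := hup (starRingEnd ℂ ζ) (by simpa [uhp] using hζ)
    rwa [cauchyTransform_conj, Complex.conj_conj, map_eq_zero] at h1
  exact (criterion_iff hφ hgH).2 fun z hz hD => key z hz.ne hD

/-! ### The orthogonal complements of the two spans -/

theorem mem_orthogonal_span_iff (S : Set L2) (g : L2) :
    g ∈ (Submodule.span ℂ S)ᗮ ↔ ∀ u ∈ S, inner ℂ u g = 0 := by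
  rw [Submodule.mem_orthogonal]
  refine ⟨fun h u hu => h u (Submodule.subset_span hu), fun h u hu => ?_⟩
  induction hu using Submodule.span_induction with
  | mem x hx => exact h x hx
  | zero => exact inner_zero_left _
  | add x y _ _ hx hy => rw [inner_add_left, hx, hy, add_zero]
  | smul a x _ hx => rw [inner_smul_left, hx, mul_zero]

theorem mem_spaceT_orthogonal_iff {φ ψ g : L2} {B : ℂ} :
    g ∈ (spaceT φ ψ B)ᗮ ↔ OrthogonalToSolutions φ ψ B g := by
  rw [spaceT, mem_orthogonal_span_iff]
  simp only [Set.mem_iUnion, OrthogonalToSolutions]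
  exact ⟨fun h μ hμ u hu => h u ⟨μ, hμ, hu⟩, fun h u ⟨μ, hμ, hu⟩ => h μ hμ u hu⟩

theorem OrthogonalToSolutions.mem_spaceS_orthogonal {φ ψ g : L2} {B μ₀ : ℂ}
    (hg : OrthogonalToSolutions φ ψ B g) (hμ₀ : μ₀ ∈ resolventSetAB φ ψ B) :
    g ∈ (spaceS φ ψ B μ₀)ᗮ := by
  rw [spaceS, mem_orthogonal_span_iff]
  have hne : ∀ δ ∈ resolventSetAB φ ψ B, δ ≠ μ₀ → ∀ u ∈ solutionRange φ ψ B μ₀, ∀ v,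
      (v, u + δ • v) ∈ graphAB φ ψ B → inner ℂ v g = 0 := by
    rintro δ hδ hne u ⟨f, hf⟩ v hv
    have h1 := hg δ hδ _ ((SolvesAt.shift hf hv).mem_solutionRange)
    rw [inner_add_left, hg μ₀ hμ₀ u ⟨f, hf⟩, zero_add, inner_smul_left] at h1
    exact (mul_eq_zero.1 h1).resolve_left ((map_ne_zero _).2 (sub_ne_zero.2 hne))
  rintro v ⟨δ, hδ, u, hu, hv⟩
  -- For δ = μ₀ the factor δ - μ₀ cannot be cancelled; the resolvent at μ₀ is approached by
  -- resolvents at μ₀ + it.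
  by_cases h : δ = μ₀
  · subst h
    obtain ⟨w, hw, hev⟩ := exists_tendsto_mem_graphAB hδ hv
    have h1 : Tendsto (fun s : ℂ => inner ℂ (w s) g) (𝓝 0) (𝓝 (inner ℂ v g)) :=
      hw.inner tendsto_const_nhds
    refine tendsto_nhds_unique (h1.comp tendsto_vertical_nhds_zero) ?_
    refine tendsto_const_nhds.congr' ?_
    filter_upwards [tendsto_vertical_nhds_zero.eventually hev, self_mem_nhdsWithin] with t ht ht0
    have ht0 : (0 : ℝ) < t := ht0
    refine (hne _ ht.1 (fun h => ?_) u hu _ ht.2).symm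
    have := congrArg Complex.im h
    simp only [Complex.add_im, Complex.mul_im, Complex.ofReal_re, Complex.I_im, mul_one,
      Complex.ofReal_im, Complex.I_re, mul_zero, add_zero, add_eq_left] at this
    exact ht0.ne' this
  · exact hne δ hδ h u hu v hv

theorem orthogonalToSolutions_of_mem_spaceS_orthogonal {φ ψ g : L2} (hφ : φ ∈ hardyPlus)
    (hψ : ψ ∈ hardyPlus) {B μ₀ : ℂ} (hB : B ≠ Real.pi * Complex.I)
    (hB' : B ≠ -(Real.pi * Complex.I)) (hμ₀ : μ₀ ∈ resolventSetAB φ ψ B)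
    (hg : g ∈ (spaceS φ ψ B μ₀)ᗮ) : OrthogonalToSolutions φ ψ B g := by
  rw [spaceS, mem_orthogonal_span_iff] at hg
  -- Since g ⊥ 𝒮_B, u may be replaced by the solution at it with the same datum f. In the upper
  -- half-plane this has q = 0, so it is f/(πi - B) times 1/(x - it), of norm O(t^(-1/2)).
  have hzero : ∀ f u, SolvesAt φ ψ B μ₀ f u → inner ℂ u g = 0 := by
    intro f u hu
    have hbd : ∀ᶠ t : ℝ in atTop, ‖inner ℂ u g‖ ≤
        ‖f / (Real.pi * Complex.I - B)‖ * (Real.pi / |t|) ^ (2 : ℝ)⁻¹ * ‖g‖ := by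
      filter_upwards [eventually_D_ne_zero φ ψ, eventually_gt_atTop 0] with t hD ht
      have him : (t * Complex.I : ℂ).im = t := by simp
      have hz : (t * Complex.I : ℂ).im ≠ 0 := by rw [him]; exact ht.ne'
      have hpos : 0 < (t * Complex.I : ℂ).im := by rw [him]; exact ht
      have hρ := mem_resolventSetAB_of_D_ne_zero hφ hψ hB hB' hz hD
      obtain ⟨v, hv⟩ := exists_mem_graphAB hρ u
      have h1 := hu.shift hv
      have h2 := hg v ⟨_, hρ, u, hu.mem_solutionRange, hv⟩
      set w := u + (t * Complex.I - μ₀) • v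
      have h3 : inner ℂ u g = inner ℂ w g := by
        rw [inner_add_left, inner_smul_left, h2, mul_zero, add_zero]
      obtain ⟨c, hc, hfc⟩ := (solvesAt_iff hz).1 h1
      have hq := inner_mul_D hz hc
      rw [cauchyTransform_conj_eq_zero hφ hpos, mul_zero] at hq
      have hq0 := (mul_eq_zero.1 hq).resolve_right hD
      rw [hq0, zero_smul, sub_zero] at hc
      rw [hq0, zero_mul, sub_zero, traceConst_of_pos hpos] at hfc
      have hc' : c = f / (Real.pi * Complex.I - B) := by
        rw [eq_div_iff (sub_ne_zero.2 hB.symm), hfc]; ring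
      have hn : ‖invSub (t * Complex.I) hz‖ = (Real.pi / |t|) ^ (2 : ℝ)⁻¹ := by
        rw [invSub, Lp.norm_toLp, eLpNorm_inv_sub hz, him, ENNReal.toReal_ofReal (by positivity)]
      rw [h3]
      refine (norm_inner_le_norm _ _).trans (le_of_eq ?_)
      rw [hc, norm_smul, hn, hc']
    have hlim : Tendsto (fun t : ℝ => ‖f / (Real.pi * Complex.I - B)‖ *
        (Real.pi / |t|) ^ (2 : ℝ)⁻¹ * ‖g‖) atTop (𝓝 0) := by
      have h3 := (tendsto_abs_atTop_atTop.const_div_atTop Real.pi).rpow_const (p := (2 : ℝ)⁻¹) (Or.inr (by norm_num))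
      rw [Real.zero_rpow (by norm_num)] at h3
      simpa using (h3.const_mul ‖f / (Real.pi * Complex.I - B)‖).mul_const ‖g‖
    exact norm_le_zero_iff.1 (ge_of_tendsto hlim hbd)
  rintro δ hδ u ⟨f, hf⟩
  have hf : SolvesAt φ ψ B δ f u := hf
  -- With p = (A_B - μ₀)⁻¹u, the function u + (μ₀ - δ)p is a solution at μ₀, and p is also (A_B -
  -- δ)⁻¹ applied to it. So p is a generator of 𝒮_B, and both pairings vanish.
  obtain ⟨p, hp⟩ := exists_mem_graphAB hμ₀ u
  have h0 := hf.shift hp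
  have h1 := hzero _ _ h0
  have h2 : inner ℂ p g = 0 := by
    refine hg p ⟨δ, hδ, _, h0.mem_solutionRange, ?_⟩
    have : u + (μ₀ - δ) • p + δ • p = u + μ₀ • p := by module
    rwa [this]
  rwa [inner_add_left, inner_smul_left, h2, mul_zero, add_zero] at h1

end Friedrichs

end

theorem mainTheorem5 (φ ψ : Friedrichs.L2)
    (hφ : φ ∈ Friedrichs.hardyPlus) (hψ : ψ ∈ Friedrichs.hardyPlus) :
    (∀ᵐ k : ℝ, ∃ d : ℂ, d ≠ 0 ∧
      Tendsto (fun ε : ℝ => Friedrichs.D φ ψ (k - ε * Complex.I)) (𝓝[>] 0) (𝓝 d)) ∧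
    (∀ g : Friedrichs.L2, ∀ᵐ k : ℝ, ∃ p : ℂ,
      Tendsto (fun ε : ℝ => Friedrichs.cauchyTransform
        (fun x => ψ x * starRingEnd ℂ (g x)) (k - ε * Complex.I)) (𝓝[>] 0) (𝓝 p)) ∧
    (∀ B : ℂ, B ≠ Real.pi * Complex.I → B ≠ -(Real.pi * Complex.I) →
      (Friedrichs.resolventSetAB φ ψ B).Nonempty ∧
      ∀ g : Friedrichs.L2,
        (∀ μ₀ ∈ Friedrichs.resolventSetAB φ ψ B,
          (g ∈ (Friedrichs.spaceS φ ψ B μ₀)ᗮ ↔ Friedrichs.Criterion φ ψ g)) ∧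
        (g ∈ (Friedrichs.spaceT φ ψ B)ᗮ ↔ Friedrichs.Criterion φ ψ g)) ∧
    (∀ g : Friedrichs.L2,
      g ∈ Friedrichs.kernelIntersection φ ψ ↔ Friedrichs.Criterion φ ψ g) := by
  refine ⟨Friedrichs.ae_tendsto_D_lower φ ψ, Friedrichs.ae_tendsto_cauchyTransform_lower ψ,
    fun B hB hB' => ⟨?_, fun g => ⟨fun μ₀ hμ₀ => ⟨fun h => ?_, fun h => ?_⟩, ?_⟩⟩,
    fun g => ⟨fun h => ?_, fun h B => h.orthogonalToSolutions hφ hψ B⟩⟩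
  · obtain ⟨t, ht, ht0⟩ :=
      ((Friedrichs.eventually_D_ne_zero φ ψ).and (eventually_gt_atTop 0)).exists
    exact ⟨_, Friedrichs.mem_resolventSetAB_of_D_ne_zero hφ hψ hB hB'
      (by simpa using ht0.ne') ht⟩
  · exact (Friedrichs.orthogonalToSolutions_of_mem_spaceS_orthogonal hφ hψ hB hB' hμ₀ h).criterion
      hφ hψ hB hB'
  · exact (h.orthogonalToSolutions hφ hψ B).mem_spaceS_orthogonal hμ₀
  · rw [Friedrichs.mem_spaceT_orthogonal_iff]
    exact ⟨fun h => h.criterion hφ hψ hB hB', fun h => h.orthogonalToSolutions hφ hψ B⟩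
  · have hpi : (Real.pi : ℂ) * Complex.I ≠ 0 :=
      mul_ne_zero (by exact_mod_cast Real.pi_ne_zero) Complex.I_ne_zero
    -- A single admissible parameter already forces the criterion; B = 0 differs from ±πi.
    exact Friedrichs.OrthogonalToSolutions.criterion (B := 0) hφ hψ hpi.symm
      (neg_ne_zero.2 hpi).symm (h 0)
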